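/- Let $(\mathfrak H,(\cdot,\cdot))$ be a complex Hilbert space and $J$ a non-trivial fundamental symmetry in $\mathfrak H$, i.e. a bounded operator with $J=J^*$, $J^2=I$, $J\neq\pm I$; put $\mathfrak H_\pm=\frac12(I\pm J)\mathfrak H$. Let $S$ be a closed densely defined symmetric operator in $\mathfrak H$ with $SJ=JS$ such that its restrictions $S_\pm=S\upharpoonright\mathfrak H_\pm$, as operators in $\mathfrak H_\pm$, have deficiency indices $\langle 1,1\rangle$. For an operator $T$ put $\mathfrak N_\mu(T)=\ker(T^*-\mu I)$, and $\mathfrak N_\mu=\mathfrak N_\mu(S)$. Assume that $S$ is simple (it induces a self-adjoint operator in no nonzero closed subspace) and that its characteristic function $$\mathsf{Sh}(\mu)=(A_\mu-iI)(A_\mu+iI)^{-1}\upharpoonright_{\mathfrak N_i},\qquad A_\mu=S^*\upharpoonright_{\mathcal D(S)\dotplus\mathfrak N_\mu},$$ vanishes for all $\mu$ with $\operatorname{Im}\mu>0$. An operator $A$ is $J$-self-adjoint if it is densely defined and $JA^*J=A$. Let $\Sigma_J$ be the set of all $J$-self-adjoint extensions of $S$, and let $\mathfrak U$ be the set of all bounded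 operators $C$ in $\mathfrak H$ with $C^2=I$, $JC>0$, $SC=CS$. Put $$\Upsilon_{\mathfrak U}=\{A\in\Sigma_J : AC=CA\ \ \forall C\in\mathfrak U\},\qquad \Upsilon_J=\{A\in\Sigma_J : AJ=JA\},\qquad \Sigma_J^{st}=\{A\in\Sigma_J : \exists\, C\in\mathfrak U,\ AC=CA\}.$$ Let $e_{++},e_{+-},e_{-+},e_{--}$ be any vectors of equal norm spanning, respectively, the one-dimensional spaces $\mathfrak N_i(S_+)$, $\mathfrak N_i(S_-)$, $\mathfrak N_{-i}(S_+)$, $\mathfrak N_{-i}(S_-)$. For a unitary matrix $U=(u_{jk})\in\mathbb C^{2\times2}$ let $A_U=S^*\upharpoonright_{\mathcal D(S)\dotplus M_U}$, where $M_U=\operatorname{span}\{d_1,d_2\}$, $$d_1=e_{++}+u_{11}e_{+-}+u_{12}e_{-+},\qquad d_2=e_{--}+u_{21}e_{+-}+u_{22}e_{-+}.$$ Then $\Upsilon_{\mathfrak U}=\emptyset$, and the inclusions $\Upsilon_{\mathfrak U}\subset\Upsilon_J\subset\Sigma_J^{st}$ hold and are both strict. Moreover, for every unitary $U$: (i) $A_U\in\Upsilon_J$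 if and only if $$U=e^{i\phi}\begin{pmatrix}0&e^{i\xi}\\-e^{-i\xi}&0\end{pmatrix}\quad\text{for some }\phi,\xi\in[0,2\pi);$$ (ii) $A_U\in\Sigma_J^{st}\setminus\Upsilon_J$ if and only if $$U=e^{i\phi}\begin{pmatrix}qe^{i\gamma}&re^{i\xi}\\-re^{-i\xi}&qe^{-i\gamma}\end{pmatrix}\quad\text{for some }\phi,\gamma,\xi\in[0,2\pi),\ q,r>0,\ q^2+r^2=1.$$ -/

import Mathlib

noncomputable section

namespace KreinExt

/-! Unbounded operators in a complex Hilbert space are `LinearPMap`s, `H →ₗ.[ℂ] H`. -/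

section Algebra

variable {H : Type*} [AddCommGroup H] [Module ℂ H]

/-- The product `B A` of two unbounded operators, with its natural domain
`{x ∈ D(A) | A x ∈ D(B)}`. -/
def opMul (B A : H →ₗ.[ℂ] H) : H →ₗ.[ℂ] H where
  domain := (B.domain.comap A.toFun).map A.domain.subtype
  toFun :=
    { toFun := fun x => B ⟨A ⟨x.1, by
          obtain ⟨y, _, hyx⟩ := Submodule.mem_map.1 x.2
          rw [← hyx]; exact y.2⟩, by
          obtain ⟨y, hy, hyx⟩ := Submodule.mem_map.1 x.2
          have e : (⟨x.1, by rw [← hyx]; exact y.2⟩ : A.domain) = y := Subtype.ext hyx.symm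
          rw [e]; exact hy⟩
      map_add' := fun x y => by
        rw [← LinearPMap.map_add]
        congr 1
        apply Subtype.ext
        exact LinearPMap.map_add A ⟨x.1, _⟩ ⟨y.1, _⟩
      map_smul' := fun c x => by
        rw [RingHom.id_apply, ← LinearPMap.map_smul]
        congr 1
        apply Subtype.ext
        exact LinearPMap.map_smul A c ⟨x.1, _⟩ }

/-- An everywhere defined operator, regarded as an unbounded operator. -/
def everywhere (C : H →ₗ[ℂ] H) : H →ₗ.[ℂ] H := C.toPMap ⊤

/-- `A - z I`, with domain `D(A)`. -/
def subScalar (A : H →ₗ.[ℂ] H) (z : ℂ) : H →ₗ.[ℂ] H :=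
  A - everywhere (z • LinearMap.id)

/-- The part of the operator `A` in the subspace `K`, as an operator in `K`: its domain is
`{x ∈ K ∩ D(A) | A x ∈ K}`. If `A` maps `D(A) ∩ K` into `K`, this is the restriction `A ↾ K`. -/
def part (A : H →ₗ.[ℂ] H) (K : Submodule ℂ H) : K →ₗ.[ℂ] K where
  domain := ((K.comap A.toFun).map A.domain.subtype).comap K.subtype
  toFun :=
    { toFun := fun x => ⟨A ⟨x.1.1, by
          obtain ⟨y, _, hyx⟩ := Submodule.mem_map.1 (Submodule.mem_comap.1 x.2)
          have e : (y : H) = x.1.1 := hyx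
          rw [← e]; exact y.2⟩, by
          obtain ⟨y, hy, hyx⟩ := Submodule.mem_map.1 (Submodule.mem_comap.1 x.2)
          have e : (⟨x.1.1, by
            have e' : (y : H) = x.1.1 := hyx
            rw [← e']; exact y.2⟩ : A.domain) = y := Subtype.ext hyx.symm
          rw [e]; exact hy⟩
      map_add' := fun x y => by
        apply Subtype.ext
        exact LinearPMap.map_add A ⟨x.1.1, _⟩ ⟨y.1.1, _⟩
      map_smul' := fun c x => by
        apply Subtype.ext
        exact LinearPMap.map_smul A c ⟨x.1.1, _⟩ }

end Algebra

variable {H : Type*} [NormedAddCommGroup H] [InnerProductSpace ℂ H]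

/-- `A C = C A` as an equality of unbounded operators (equal domains included), `C` bounded. -/
def Commutes (A : H →ₗ.[ℂ] H) (C : H →L[ℂ] H) : Prop :=
  opMul A (everywhere (C : H →ₗ[ℂ] H)) = opMul (everywhere (C : H →ₗ[ℂ] H)) A

variable [CompleteSpace H]

/-- A non-trivial fundamental symmetry: `J = J*`, `J² = I`, `J ≠ ± I`. -/
structure FundamentalSymmetry (H : Type*) [NormedAddCommGroup H] [InnerProductSpace ℂ H]
    [CompleteSpace H] where
  op : H →L[ℂ] H
  isSelfAdjoint : IsSelfAdjoint op
  sq_eq_one : op * op = 1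
  ne_one : op ≠ 1
  ne_neg_one : op ≠ -1

namespace FundamentalSymmetry

variable (J : FundamentalSymmetry H)

/-- `H₊ = P₊ H`, where `P₊ = (I + J) / 2`. -/
def plus : Submodule ℂ H :=
  LinearMap.range (((1 / 2 : ℂ) • (1 + J.op) : H →L[ℂ] H) : H →ₗ[ℂ] H)

/-- `H₋ = P₋ H`, where `P₋ = (I - J) / 2`. -/
def minus : Submodule ℂ H :=
  LinearMap.range (((1 / 2 : ℂ) • (1 - J.op) : H →L[ℂ] H) : H →ₗ[ℂ] H)

theorem op_op (x : H) : J.op (J.op x) = x := by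
  have h := congrArg (fun T : H →L[ℂ] H => T x) J.sq_eq_one
  simpa using h

theorem mem_plus (x : H) : x ∈ J.plus ↔ J.op x = x := by
  constructor
  · rintro ⟨y, rfl⟩
    simp [J.op_op, add_comm]
  · intro h
    refine ⟨x, ?_⟩
    simp only [ContinuousLinearMap.coe_coe, smul_apply,
      add_apply, one_apply_eq_self, h]
    rw [← two_smul ℂ x, smul_smul]
    norm_num

theorem mem_minus (x : H) : x ∈ J.minus ↔ J.op x = -x := by
  constructor
  · rintro ⟨y, rfl⟩
    simp [J.op_op, ← smul_neg]
  · intro h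
    refine ⟨x, ?_⟩
    simp only [ContinuousLinearMap.coe_coe, smul_apply,
      sub_apply, one_apply_eq_self, h]
    rw [sub_neg_eq_add, ← two_smul ℂ x, smul_smul]
    norm_num

instance instCompletePlus : CompleteSpace J.plus := by
  have h : IsClosed (J.plus : Set H) := by
    have e : (J.plus : Set H) = {x | J.op x = x} := Set.ext fun x => J.mem_plus x
    rw [e]
    exact isClosed_eq J.op.continuous continuous_id
  exact h.completeSpace_coe

instance instCompleteMinus : CompleteSpace J.minus := by
  have h : IsClosed (J.minus : Set H) := by
    have e : (J.minus : Set H) = {x | J.op x = -x} := Set.ext fun x => J.mem_minus x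
    rw [e]
    exact isClosed_eq J.op.continuous continuous_neg
  exact h.completeSpace_coe

end FundamentalSymmetry

/-- The defect subspace `N_μ = ker (S* - μ I)`. -/
def defectSpace (S : H →ₗ.[ℂ] H) (μ : ℂ) : Submodule ℂ H where
  carrier := {x | ∃ h : x ∈ S.adjoint.domain, S.adjoint ⟨x, h⟩ = μ • x}
  zero_mem' := ⟨Submodule.zero_mem _, by
    rw [smul_zero]; exact LinearPMap.map_zero S.adjoint⟩
  add_mem' := by
    rintro x y ⟨hx, ex⟩ ⟨hy, ey⟩
    refine ⟨Submodule.add_mem _ hx hy, ?_⟩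
    rw [smul_add, ← ex, ← ey]
    exact LinearPMap.map_add S.adjoint ⟨x, hx⟩ ⟨y, hy⟩
  smul_mem' := by
    rintro c x ⟨hx, ex⟩
    refine ⟨Submodule.smul_mem _ c hx, ?_⟩
    rw [smul_comm, ← ex]
    exact LinearPMap.map_smul S.adjoint c ⟨x, hx⟩

/-- `S` has deficiency indices `<1, 1>`. -/
def HasDeficiencyIndicesOne (S : H →ₗ.[ℂ] H) : Prop :=
  Module.finrank ℂ (defectSpace S Complex.I) = 1 ∧
    Module.finrank ℂ (defectSpace S (-Complex.I)) = 1

/-- `S` is simple: there is no nonzero closed subspace in which `S` induces a self-adjoint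
operator. (For symmetric `S`, a closed subspace in which the part of `S` is self-adjoint
automatically reduces `S`.) -/
def IsSimple (S : H →ₗ.[ℂ] H) : Prop :=
  ∀ (K : Submodule ℂ H) [CompleteSpace K], IsSelfAdjoint (part S K) → K = ⊥

/-- `A_μ = S* ↾ (D(S) + N_μ)`. -/
def dissipativeExt (S : H →ₗ.[ℂ] H) (μ : ℂ) : H →ₗ.[ℂ] H :=
  S.adjoint.domRestrict (S.domain ⊔ defectSpace S μ)

/-- The (Straus) characteristic function `Sh(μ) = (A_μ - i I) (A_μ + i I)⁻¹ ↾ N_i` of `S`,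
for `μ` in the open upper half-plane. -/
def charFunction (S : H →ₗ.[ℂ] H) (μ : ℂ) : H →ₗ.[ℂ] H :=
  (opMul (subScalar (dissipativeExt S μ) Complex.I)
    (subScalar (dissipativeExt S μ) (-Complex.I)).inverse).domRestrict (defectSpace S Complex.I)

/-- `Sh(μ)` is the zero operator on `N_i` for every `μ` in the open upper half-plane. -/
def HasZeroCharFunction (S : H →ₗ.[ℂ] H) : Prop :=
  ∀ μ : ℂ, 0 < μ.im →
    charFunction S μ = (0 : H →ₗ[ℂ] H).toPMap (defectSpace S Complex.I)

section Extensions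

variable (J : FundamentalSymmetry H) (S : H →ₗ.[ℂ] H)

/-- The adjoint `J A* J` of `A` with respect to the indefinite inner product `(J ·, ·)`. -/
def kreinAdjoint (A : H →ₗ.[ℂ] H) : H →ₗ.[ℂ] H :=
  opMul (everywhere (J.op : H →ₗ[ℂ] H))
    (opMul A.adjoint (everywhere (J.op : H →ₗ[ℂ] H)))

/-- `A` is `J`-self-adjoint. -/
def IsJSelfAdjoint (A : H →ₗ.[ℂ] H) : Prop :=
  Dense (A.domain : Set H) ∧ kreinAdjoint J A = A

/-- `Σ_J`: all `J`-self-adjoint extensions of `S`. -/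
def SigmaJ : Set (H →ₗ.[ℂ] H) := {A | S ≤ A ∧ IsJSelfAdjoint J A}

/-- `𝔘`: all bounded `C` with `C² = I`, `J C > 0` and `S C = C S`. -/
def CSymmetries : Set (H →L[ℂ] H) :=
  {C | C * C = 1 ∧
    (IsSelfAdjoint (J.op * C) ∧ ∀ x : H, x ≠ 0 → 0 < (inner ℂ ((J.op * C) x) x).re) ∧
    Commutes S C}

/-- `Υ_J`: the extensions in `Σ_J` that commute with `J`. -/
def UpsilonJ : Set (H →ₗ.[ℂ] H) := {A | A ∈ SigmaJ J S ∧ Commutes A J.op}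

/-- `Σ_J^{st}`: the extensions in `Σ_J` that commute with some `C ∈ 𝔘`. -/
def SigmaJst : Set (H →ₗ.[ℂ] H) :=
  {A | A ∈ SigmaJ J S ∧ ∃ C ∈ CSymmetries J S, Commutes A C}

/-- `Υ_𝔘`: the extensions in `Σ_J` that commute with every `C ∈ 𝔘`. -/
def UpsilonU : Set (H →ₗ.[ℂ] H) :=
  {A | A ∈ SigmaJ J S ∧ ∀ C ∈ CSymmetries J S, Commutes A C}

/-- Vectors `e_{++}, e_{+-}, e_{-+}, e_{--}` spanning the one-dimensional defect subspaces
`N_i(S₊), N_i(S₋), N_{-i}(S₊), N_{-i}(S₋)` of the parts `S₊, S₋` of `S` in `H₊, H₋`, and having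
equal norms. (On `N_i` and on `N_{-i}` the norm of `𝔐 = N_i + N_{-i}` is `√2` times the norm of
`H`, and the four vectors are automatically orthogonal in `𝔐`.) -/
structure DefectBasis where
  epp : J.plus
  epm : J.minus
  emp : J.plus
  emm : J.minus
  span_epp : Submodule.span ℂ {epp} = defectSpace (part S J.plus) Complex.I
  span_epm : Submodule.span ℂ {epm} = defectSpace (part S J.minus) Complex.I
  span_emp : Submodule.span ℂ {emp} = defectSpace (part S J.plus) (-Complex.I)
  span_emm : Submodule.span ℂ {emm} = defectSpace (part S J.minus) (-Complex.I)
  norm_epm : ‖epm‖ = ‖epp‖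
  norm_emp : ‖emp‖ = ‖epp‖
  norm_emm : ‖emm‖ = ‖epp‖

variable {J S}

/-- `M_U = span {d₁, d₂}`, `d₁ = e_{++} + U₁₁ e_{+-} + U₁₂ e_{-+}`,
`d₂ = e_{--} + U₂₁ e_{+-} + U₂₂ e_{-+}`. -/
def neutralSpace (e : DefectBasis J S) (U : Matrix (Fin 2) (Fin 2) ℂ) : Submodule ℂ H :=
  Submodule.span ℂ
    {(e.epp : H) + U 0 0 • (e.epm : H) + U 0 1 • (e.emp : H),
     (e.emm : H) + U 1 0 • (e.epm : H) + U 1 1 • (e.emp : H)}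

/-- `A_U = S* ↾ (D(S) + M_U)`. -/
def extOfMatrix (e : DefectBasis J S) (U : Matrix (Fin 2) (Fin 2) ℂ) : H →ₗ.[ℂ] H :=
  S.adjoint.domRestrict (S.domain ⊔ neutralSpace e U)

end Extensions

end KreinExt

end

/-! Everything rests on the Cayley transform `T` of `S`, the partial isometry from ran(S + i) onto
ran(S - i), extended by zero to N_i; its adjoint kills N_{-i}. If the characteristic function
vanishes at μ = i(1 + ε)/(1 - ε), then for each n in N_i the equation w - ε T* w = n has a solution
orthogonal to N_{-i}. Expanding w in powers of ε and letting ε tend to 0 gives that N_{-i} is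
orthogonal to T*ᵏ N_i for every k (`inner_defect_pow_adjoint_cayley`). So T* is an isometric shift
along the orbit of N_i, T is one along the orbit of N_{-i}, and the two orbits are orthogonal. What
is orthogonal to both reduces T and carries a self-adjoint part of S, so simplicity makes the orbits
total (`eq_zero_of_orthogonal_orbit`).

On each orbit vector J is a sign, so the orbits in H₊ and H₋ can be interchanged with prescribed
phases, chosen independently over N_i and N_{-i}. This yields unitary involutions R that preserve S
and anticommute with J (`exists_swap`), and then C = J(a + bR) lies in 𝔘 whenever a > 0 and a² - b²
= 1 (`op_mul_mem_CSymmetries`).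

An extension commuting with all of 𝔘 is self-adjoint and commutes with two such R whose product is 1
on N_i and -1 on N_{-i}. Its domain then splits along N_i and N_{-i}; nonreal eigenvalues being
impossible, it is S itself, which is not self-adjoint. Hence Υ_𝔘 is empty.

For A_U, the boundary form of S* twisted by J has signature (+, -, -, +) in the four defect
coordinates, and M_U is the graph of a unitary map from the positive to the negative plane. This
makes A_U J-self-adjoint. Commutation with J means u₁₁ = 0. If u₁₂ = 0, then d₁ is an eigenvector of
A_U in N_i with (J d₁, d₁) = 0, which no C in 𝔘 tolerates (`ne_zero_of_mem_SigmaJst`). If u₁₁ and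
u₁₂ are both nonzero, a suitable J(a + bR) maps M_U into itself (`extOfMatrix_mem_SigmaJst`). What
remains is the parametrization of unitary 2 × 2 matrices. -/

namespace KreinExt

/-! ### Unbounded operators described by their graphs. -/

section GraphAlgebra

variable {H : Type*} [AddCommGroup H] [Module ℂ H]

theorem mem_graph_iff_exists {A : H →ₗ.[ℂ] H} {x y : H} :
    (x, y) ∈ A.graph ↔ ∃ h : x ∈ A.domain, A ⟨x, h⟩ = y := by
  rw [LinearPMap.mem_graph_iff]
  constructor
  · rintro ⟨z, rfl, h⟩
    exact ⟨z.2, h⟩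
  · rintro ⟨h, e⟩
    exact ⟨⟨x, h⟩, rfl, e⟩

theorem mem_graph_opMul {A B : H →ₗ.[ℂ] H} {x z : H} :
    (x, z) ∈ (opMul B A).graph ↔ ∃ y, (x, y) ∈ A.graph ∧ (y, z) ∈ B.graph := by
  simp only [mem_graph_iff_exists]
  constructor
  · rintro ⟨h, e⟩
    obtain ⟨y, hy, hyx⟩ := Submodule.mem_map.1 h
    subst hyx
    exact ⟨A y, ⟨y.2, rfl⟩, hy, e⟩
  · rintro ⟨y, ⟨h, rfl⟩, hb, e⟩
    exact ⟨Submodule.mem_map.2 ⟨⟨x, h⟩, hb, rfl⟩, e⟩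

theorem mem_graph_everywhere {C : H →ₗ[ℂ] H} {x y : H} :
    (x, y) ∈ (everywhere C).graph ↔ C x = y := by
  rw [mem_graph_iff_exists]
  exact ⟨fun ⟨_, e⟩ => e, fun e => ⟨Submodule.mem_top, e⟩⟩

theorem mem_graph_subScalar {A : H →ₗ.[ℂ] H} {z : ℂ} {x y : H} :
    (x, y) ∈ (subScalar A z).graph ↔ (x, y + z • x) ∈ A.graph := by
  simp only [mem_graph_iff_exists]
  constructor
  · rintro ⟨h, e⟩
    refine ⟨h.1, ?_⟩
    rw [← e]
    exact (sub_add_cancel _ _).symm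
  · rintro ⟨h, e⟩
    refine ⟨⟨h, Submodule.mem_top⟩, ?_⟩
    change A ⟨x, h⟩ - z • x = y
    rw [e, add_sub_cancel_right]

theorem mem_graph_part {A : H →ₗ.[ℂ] H} {K : Submodule ℂ H} {x y : K} :
    (x, y) ∈ (part A K).graph ↔ ((x : H), (y : H)) ∈ A.graph := by
  rw [mem_graph_iff_exists, mem_graph_iff_exists]
  constructor
  · rintro ⟨h, e⟩
    obtain ⟨z, hz, hzx⟩ := Submodule.mem_map.1 (Submodule.mem_comap.1 h)
    have hx : (x : H) ∈ A.domain := by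
      have e' : (z : H) = x := hzx
      rw [← e']
      exact z.2
    exact ⟨hx, congrArg Subtype.val e⟩
  · rintro ⟨h, e⟩
    refine ⟨Submodule.mem_comap.2 (Submodule.mem_map.2 ⟨⟨x, h⟩, ?_, rfl⟩), Subtype.ext e⟩
    change A ⟨x, h⟩ ∈ K
    rw [e]
    exact y.2

theorem mem_graph_domRestrict {A : H →ₗ.[ℂ] H} {D : Submodule ℂ H} {x y : H} :
    (x, y) ∈ (A.domRestrict D).graph ↔ x ∈ D ∧ (x, y) ∈ A.graph := by
  rw [mem_graph_iff_exists, mem_graph_iff_exists]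
  constructor
  · rintro ⟨h, e⟩
    exact ⟨h.1, h.2, e⟩
  · rintro ⟨hD, h, e⟩
    exact ⟨⟨hD, h⟩, e⟩

/-- The swapped graph is single-valued only for injective `A`, so injectivity has to be known before
`LinearPMap.inverse` can be used. -/
theorem mem_graph_inverse {A : H →ₗ.[ℂ] H} (hA : ∀ x, (x, (0 : H)) ∈ A.graph → x = 0) {x y : H} :
    (x, y) ∈ A.inverse.graph ↔ (y, x) ∈ A.graph := by
  have hk : LinearMap.ker A.toFun = ⊥ := by
    rw [LinearMap.ker_eq_bot']
    intro z hz
    exact Subtype.ext (hA z (mem_graph_iff_exists.2 ⟨z.2, hz⟩))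
  rw [LinearPMap.inverse_graph hk, Submodule.mem_map]
  constructor
  · rintro ⟨⟨a, b⟩, h, e⟩
    obtain ⟨rfl, rfl⟩ := Prod.mk.inj e
    exact h
  · intro h
    exact ⟨(y, x), h, rfl⟩

theorem graph_ext {A B : H →ₗ.[ℂ] H} (h : ∀ x y, (x, y) ∈ A.graph ↔ (x, y) ∈ B.graph) :
    A = B :=
  LinearPMap.eq_of_eq_graph (Submodule.ext fun p => h p.1 p.2)

theorem graph_add {A : H →ₗ.[ℂ] H} {x y x' y' : H} (h : (x, y) ∈ A.graph)
    (h' : (x', y') ∈ A.graph) : (x + x', y + y') ∈ A.graph :=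
  A.graph.add_mem h h'

theorem graph_sub {A : H →ₗ.[ℂ] H} {x y x' y' : H} (h : (x, y) ∈ A.graph)
    (h' : (x', y') ∈ A.graph) : (x - x', y - y') ∈ A.graph :=
  A.graph.sub_mem h h'

theorem graph_smul {A : H →ₗ.[ℂ] H} {x y : H} (c : ℂ) (h : (x, y) ∈ A.graph) :
    (c • x, c • y) ∈ A.graph :=
  A.graph.smul_mem c h

end GraphAlgebra

/-! ### Commutation, symmetric operators and adjoints. -/

variable {H : Type*} [NormedAddCommGroup H] [InnerProductSpace ℂ H]

theorem commutes_iff {A : H →ₗ.[ℂ] H} {C : H →L[ℂ] H} :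
    Commutes A C ↔ ∀ x z, (C x, z) ∈ A.graph ↔ ∃ y, (x, y) ∈ A.graph ∧ C y = z := by
  have key : ∀ x z, ((x, z) ∈ (opMul A (everywhere (C : H →ₗ[ℂ] H))).graph ↔
      (C x, z) ∈ A.graph) ∧ ((x, z) ∈ (opMul (everywhere (C : H →ₗ[ℂ] H)) A).graph ↔
      ∃ y, (x, y) ∈ A.graph ∧ C y = z) := by
    intro x z
    simp only [mem_graph_opMul, mem_graph_everywhere, ContinuousLinearMap.coe_coe]
    exact ⟨⟨fun ⟨_, e, h⟩ => e ▸ h, fun h => ⟨_, rfl, h⟩⟩, trivial⟩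
  constructor
  · intro h x z
    rw [← (key x z).1, ← (key x z).2, show opMul A _ = _ from h]
  · intro h
    exact graph_ext fun x z => by rw [(key x z).1, (key x z).2, h]

theorem Commutes.mem_graph {A : H →ₗ.[ℂ] H} {C : H →L[ℂ] H} (h : Commutes A C) {x y : H}
    (hx : (x, y) ∈ A.graph) : (C x, C y) ∈ A.graph :=
  (commutes_iff.1 h x (C y)).2 ⟨y, hx, rfl⟩

/-- For an involution one inclusion suffices: applying it a second time gives equality of the
domains. -/
theorem commutes_of_involutive {A : H →ₗ.[ℂ] H} {C : H →L[ℂ] H} (hC : ∀ x, C (C x) = x)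
    (h : ∀ x y, (x, y) ∈ A.graph → (C x, C y) ∈ A.graph) : Commutes A C := by
  rw [commutes_iff]
  intro x z
  constructor
  · intro hx
    refine ⟨C z, ?_, hC z⟩
    have := h _ _ hx
    rwa [hC] at this
  · rintro ⟨y, hxy, rfl⟩
    exact h _ _ hxy

/-- A densely defined symmetric operator, described through its graph. -/
structure IsDenselySymmetric (S : H →ₗ.[ℂ] H) : Prop where
  dense : Dense (S.domain : Set H)
  symm : ∀ {u v u' v' : H}, (u, v) ∈ S.graph → (u', v') ∈ S.graph →
    inner ℂ v u' = inner ℂ u v'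

theorem isDenselySymmetric_of_isFormalAdjoint {S : H →ₗ.[ℂ] H} (hd : Dense (S.domain : Set H))
    (hs : S.IsFormalAdjoint S) : IsDenselySymmetric S := by
  refine ⟨hd, fun {u v u' v'} h h' => ?_⟩
  obtain ⟨a, rfl⟩ := mem_graph_iff_exists.1 h
  obtain ⟨b, rfl⟩ := mem_graph_iff_exists.1 h'
  exact hs ⟨u, a⟩ ⟨u', b⟩

namespace IsDenselySymmetric

variable {S : H →ₗ.[ℂ] H} (hS : IsDenselySymmetric S)

include hS

/-- Symmetry makes (Su, u) real, so the cross term with an imaginary factor has zero real part. -/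
theorem norm_sq_shift {u v : H} (h : (u, v) ∈ S.graph) {ε : ℂ} (hε : ε = Complex.I ∨ ε = -Complex.I) :
    ‖v + ε • u‖ ^ 2 = ‖v‖ ^ 2 + ‖u‖ ^ 2 := by
  have hsym := hS.symm h h
  have hre : (inner ℂ v (ε • u)).re = 0 := by
    have h2 : (inner ℂ u v).im = 0 := by
      have := inner_conj_symm (𝕜 := ℂ) u v
      rw [hsym] at this
      exact Complex.conj_eq_iff_im.1 this
    rw [inner_smul_right, hsym]
    rcases hε with rfl | rfl <;> simp [h2]
  have hn : ‖ε • u‖ = ‖u‖ := by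
    rw [norm_smul]
    rcases hε with rfl | rfl <;> simp
  have := norm_add_sq (𝕜 := ℂ) v (ε • u)
  rw [this, hn]
  simp [hre]

theorem inner_cayley {u v u' v' : H} (h : (u, v) ∈ S.graph) (h' : (u', v') ∈ S.graph) :
    inner ℂ (v - Complex.I • u) (v' - Complex.I • u') =
      inner ℂ (v + Complex.I • u) (v' + Complex.I • u') := by
  have h1 := hS.symm h h'
  simp only [inner_add_left, inner_add_right, inner_sub_left, inner_sub_right, inner_smul_left,
    inner_smul_right, h1, Complex.conj_I]
  ring

end IsDenselySymmetric

section Hilbert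

variable [CompleteSpace H]

theorem mem_graph_adjoint {A : H →ₗ.[ℂ] H} (hA : Dense (A.domain : Set H)) {x y : H} :
    (x, y) ∈ A.adjoint.graph ↔ ∀ u v, (u, v) ∈ A.graph → inner ℂ v x = inner ℂ u y := by
  rw [LinearPMap.adjoint_graph_eq_graph_adjoint hA, Submodule.mem_adjoint_iff]
  simp only [sub_eq_zero]

theorem mem_defectSpace {S : H →ₗ.[ℂ] H} {μ : ℂ} {x : H} :
    x ∈ defectSpace S μ ↔ (x, μ • x) ∈ S.adjoint.graph := by
  rw [mem_graph_iff_exists]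
  exact Iff.rfl

namespace IsDenselySymmetric

variable {S : H →ₗ.[ℂ] H} (hS : IsDenselySymmetric S)

include hS

theorem mem_adjoint_iff {x y : H} :
    (x, y) ∈ S.adjoint.graph ↔ ∀ u v, (u, v) ∈ S.graph → inner ℂ v x = inner ℂ u y :=
  mem_graph_adjoint hS.dense

theorem mem_adjoint_of_mem {u v : H} (h : (u, v) ∈ S.graph) : (u, v) ∈ S.adjoint.graph :=
  hS.mem_adjoint_iff.2 fun _ _ h' => hS.symm h' h

theorem mem_defect_iff {μ : ℂ} {x : H} :
    x ∈ defectSpace S μ ↔ ∀ u v, (u, v) ∈ S.graph → inner ℂ v x = μ * inner ℂ u x := by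
  rw [mem_defectSpace, hS.mem_adjoint_iff]
  simp only [inner_smul_right]

/-- A bounded operator whose adjoint preserves `S` preserves `S*`. -/
theorem adjoint_map_mem {C : H →L[ℂ] H}
    (hC : ∀ u v, (u, v) ∈ S.graph →
      (ContinuousLinearMap.adjoint C u, ContinuousLinearMap.adjoint C v) ∈ S.graph) {x y : H}
    (h : (x, y) ∈ S.adjoint.graph) : (C x, C y) ∈ S.adjoint.graph := by
  rw [hS.mem_adjoint_iff] at h ⊢
  intro u v huv
  rw [← ContinuousLinearMap.adjoint_inner_left, ← ContinuousLinearMap.adjoint_inner_left]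
  exact h _ _ (hC u v huv)

end IsDenselySymmetric

end Hilbert

end KreinExt

/-! ### Von Neumann's formula and the Cayley transform. -/

namespace KreinExt

variable {H : Type*} [NormedAddCommGroup H] [InnerProductSpace ℂ H]

/-- The map `(u, S u) ↦ S u + ε u` on the graph of `S`. -/
def shiftMap (S : H →ₗ.[ℂ] H) (ε : ℂ) : S.graph →ₗ[ℂ] H :=
  (LinearMap.snd ℂ H H + ε • LinearMap.fst ℂ H H).comp S.graph.subtype

theorem shiftMap_apply (S : H →ₗ.[ℂ] H) (ε : ℂ) (p : S.graph) :
    shiftMap S ε p = p.1.2 + ε • p.1.1 := rfl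

theorem IsDenselySymmetric.norm_le_shiftMap {S : H →ₗ.[ℂ] H} (hS : IsDenselySymmetric S) {ε : ℂ}
    (hε : ε = Complex.I ∨ ε = -Complex.I) (p : S.graph) : ‖p‖ ≤ ‖shiftMap S ε p‖ := by
  obtain ⟨⟨u, v⟩, h⟩ := p
  have h2 := hS.norm_sq_shift h hε
  rw [shiftMap_apply]
  change max ‖u‖ ‖v‖ ≤ ‖v + ε • u‖
  refine max_le ?_ ?_ <;> refine le_of_sq_le_sq ?_ (norm_nonneg _) <;>
    nlinarith [sq_nonneg ‖u‖, sq_nonneg ‖v‖]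

variable [CompleteSpace H]

namespace IsDenselySymmetric

variable {S : H →ₗ.[ℂ] H} (hS : IsDenselySymmetric S)

include hS

/-- The graph of a closed operator is complete, and the shift map does not decrease its sup norm, so
its range is closed. -/
theorem isClosed_range_shiftMap (hc : S.IsClosed) {ε : ℂ}
    (hε : ε = Complex.I ∨ ε = -Complex.I) :
    IsClosed (LinearMap.range (shiftMap S ε) : Set H) := by
  have hg : CompleteSpace S.graph := IsClosed.completeSpace_coe (hs := hc)
  have hanti : AntilipschitzWith 1 (shiftMap S ε) :=
    AddMonoidHomClass.antilipschitz_of_bound _ fun p => by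
      simpa using hS.norm_le_shiftMap hε p
  have hcont : UniformContinuous (shiftMap S ε) := by
    have : LipschitzWith (Real.toNNReal (1 + ‖ε‖)) (shiftMap S ε) := by
      refine AddMonoidHomClass.lipschitz_of_bound _ _ fun p => ?_
      rw [shiftMap_apply]
      have h1 : ‖p.1.1‖ ≤ ‖p‖ := le_max_left _ _
      have h2 : ‖p.1.2‖ ≤ ‖p‖ := le_max_right _ _
      calc ‖p.1.2 + ε • p.1.1‖ ≤ ‖p.1.2‖ + ‖ε‖ * ‖p.1.1‖ := by
            rw [← norm_smul]; exact norm_add_le _ _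
        _ ≤ (1 + ‖ε‖) * ‖p‖ := by nlinarith [norm_nonneg ε]
    exact this.uniformContinuous
  have := hanti.isClosed_range hcont
  rwa [LinearMap.coe_range]

/-- Since ε is imaginary, -conj ε = ε, so the complement of ran(S + ε) belongs to the same ε and not
to its conjugate. -/
theorem orthogonal_range_shiftMap {ε : ℂ} (hε : ε = Complex.I ∨ ε = -Complex.I) :
    (LinearMap.range (shiftMap S ε))ᗮ = defectSpace S ε := by
  ext x
  rw [Submodule.mem_orthogonal, hS.mem_defect_iff]
  have hconj : (starRingEnd ℂ) ε = -ε := by rcases hε with rfl | rfl <;> simp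
  have key : ∀ u v : H, inner ℂ (v + ε • u) x = 0 ↔ inner ℂ v x = ε * inner ℂ u x := by
    intro u v
    rw [inner_add_left, inner_smul_left, hconj, neg_mul, ← sub_eq_add_neg, sub_eq_zero]
  constructor
  · intro h u v huv
    exact (key u v).1 (h _ ⟨⟨(u, v), huv⟩, rfl⟩)
  · rintro h _ ⟨⟨⟨u, v⟩, huv⟩, rfl⟩
    exact (key u v).2 (h u v huv)

theorem inner_shift_defect {ε : ℂ} (hε : ε = Complex.I ∨ ε = -Complex.I) {u v n : H}
    (h : (u, v) ∈ S.graph) (hn : n ∈ defectSpace S ε) : inner ℂ (v + ε • u) n = 0 := by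
  rw [← hS.orthogonal_range_shiftMap hε] at hn
  exact (Submodule.mem_orthogonal _ _).1 hn _ ⟨⟨(u, v), h⟩, rfl⟩

theorem exists_shift_add_defect (hc : S.IsClosed) {ε : ℂ}
    (hε : ε = Complex.I ∨ ε = -Complex.I) (x : H) :
    ∃ u v n, (u, v) ∈ S.graph ∧ n ∈ defectSpace S ε ∧ x = v + ε • u + n := by
  have : CompleteSpace (LinearMap.range (shiftMap S ε)) :=
    (hS.isClosed_range_shiftMap hc hε).completeSpace_coe
  obtain ⟨y, ⟨⟨⟨u, v⟩, h⟩, rfl⟩, n, hn, rfl⟩ :=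
    (LinearMap.range (shiftMap S ε)).exists_add_mem_mem_orthogonal x
  rw [hS.orthogonal_range_shiftMap hε] at hn
  exact ⟨u, v, n, h, hn, rfl⟩

theorem exists_shift_of_orthogonal (hc : S.IsClosed) {ε : ℂ}
    (hε : ε = Complex.I ∨ ε = -Complex.I) {x : H} (hx : ∀ n ∈ defectSpace S ε, inner ℂ n x = 0) :
    ∃ u v, (u, v) ∈ S.graph ∧ x = v + ε • u := by
  obtain ⟨u, v, n, h, hn, rfl⟩ := hS.exists_shift_add_defect hc hε x
  have h0 := hx n hn
  rw [inner_add_right, ← inner_conj_symm, hS.inner_shift_defect hε h hn, map_zero, zero_add,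
    inner_self_eq_zero] at h0
  exact ⟨u, v, h, by rw [h0, add_zero]⟩

/-- Von Neumann's formula `D(S*) = D(S) + N_i + N_{-i}`. -/
theorem exists_vonNeumann (hc : S.IsClosed) {x y : H} (h : (x, y) ∈ S.adjoint.graph) :
    ∃ u v n m, (u, v) ∈ S.graph ∧ n ∈ defectSpace S Complex.I ∧ m ∈ defectSpace S (-Complex.I) ∧
      x = u + n + m ∧ y = v + Complex.I • n - Complex.I • m := by
  -- S* + i kills N_{-i} and multiplies N_i by 2i. Decomposing (S* + i)x therefore finds the D(S)
  -- and N_i components, the latter up to the factor 2i.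
  obtain ⟨u, v, n, huv, hn, e⟩ := hS.exists_shift_add_defect hc (Or.inl rfl) (y + Complex.I • x)
  set n' := (1 / (2 * Complex.I)) • n with hn'
  have hn'mem : n' ∈ defectSpace S Complex.I := Submodule.smul_mem _ _ hn
  have hnn : n = (2 * Complex.I) • n' := by
    rw [hn', smul_smul, mul_one_div_cancel (by simp), one_smul]
  have hm := graph_sub (graph_sub h (hS.mem_adjoint_of_mem huv)) (mem_defectSpace.1 hn'mem)
  have hy : y - v - Complex.I • n' = (-Complex.I) • (x - u - n') := by
    rw [hnn] at e
    have e' : y = v + Complex.I • u + (2 * Complex.I) • n' - Complex.I • x := by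
      rw [← e, add_sub_cancel_right]
    rw [e']
    module
  refine ⟨u, v, n', x - u - n', huv, hn'mem, mem_defectSpace.2 (hy ▸ hm), by abel, ?_⟩
  have hy' : y = v + Complex.I • n' + (y - v - Complex.I • n') := by abel
  rw [hy', hy]
  module

/-- Applying S* + i removes m and leaves (S + i)u + 2i n = 0, a sum of orthogonal vectors. -/
theorem eq_zero_of_vonNeumann {u v n m : H} (h : (u, v) ∈ S.graph)
    (hn : n ∈ defectSpace S Complex.I) (hm : m ∈ defectSpace S (-Complex.I))
    (e : u + n + m = 0) : u = 0 ∧ n = 0 ∧ m = 0 := by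
  have hg := graph_add (graph_add (hS.mem_adjoint_of_mem h) (mem_defectSpace.1 hn))
    (mem_defectSpace.1 hm)
  have e2 : v + Complex.I • n + -Complex.I • m = 0 :=
    LinearPMap.graph_fst_eq_zero_snd _ hg e
  have e3 : v + Complex.I • u + (2 * Complex.I) • n = 0 := by
    have : v + Complex.I • u + (2 * Complex.I) • n =
        (v + Complex.I • n + -Complex.I • m) + Complex.I • (u + n + m) := by module
    rw [this, e2, e, smul_zero, add_zero]
  have hn0 : n = 0 := by
    have h1 := hS.inner_shift_defect (Or.inl rfl) h hn
    have h2 : inner ℂ (v + Complex.I • u + (2 * Complex.I) • n) n = 0 := by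
      rw [e3, inner_zero_left]
    rw [inner_add_left, h1, zero_add, inner_smul_left] at h2
    have h3 : (starRingEnd ℂ) (2 * Complex.I) ≠ 0 := by
      rw [Ne, map_eq_zero]; simp
    exact inner_self_eq_zero.1 ((mul_eq_zero.1 h2).resolve_left h3)
  have hu0 : u = 0 := by
    rw [hn0, smul_zero, add_zero] at e3
    have h1 := hS.norm_sq_shift h (Or.inl rfl)
    rw [e3, norm_zero] at h1
    have : ‖u‖ ^ 2 = 0 := by nlinarith [sq_nonneg ‖u‖, sq_nonneg ‖v‖]
    simpa using this
  refine ⟨hu0, hn0, ?_⟩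
  simpa [hu0, hn0] using e

/-- Uniqueness in von Neumann's formula. -/
theorem vonNeumann_unique {u v n m u' v' n' m' : H} (h : (u, v) ∈ S.graph)
    (hn : n ∈ defectSpace S Complex.I) (hm : m ∈ defectSpace S (-Complex.I))
    (h' : (u', v') ∈ S.graph)
    (hn' : n' ∈ defectSpace S Complex.I) (hm' : m' ∈ defectSpace S (-Complex.I))
    (e : u + n + m = u' + n' + m') : u = u' ∧ n = n' ∧ m = m' := by
  have := hS.eq_zero_of_vonNeumann (graph_sub h h') (Submodule.sub_mem _ hn hn')
    (Submodule.sub_mem _ hm hm') (by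
      have : u - u' + (n - n') + (m - m') = (u + n + m) - (u' + n' + m') := by abel
      rw [this, e, sub_self])
  simpa only [sub_eq_zero] using this

end IsDenselySymmetric

/-- `T` is the Cayley transform `(S - i)(S + i)⁻¹`, extended by zero to `N_i`. -/
structure IsCayley (S : H →ₗ.[ℂ] H) (T : H →L[ℂ] H) : Prop where
  map_shift : ∀ {u v : H}, (u, v) ∈ S.graph → T (v + Complex.I • u) = v - Complex.I • u
  map_defect : ∀ {n : H}, n ∈ defectSpace S Complex.I → T n = 0

namespace IsDenselySymmetric

variable {S : H →ₗ.[ℂ] H} (hS : IsDenselySymmetric S)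

include hS

/-- Invert S + i on its closed range, apply S - i, and precompose with the orthogonal projection; by
`norm_sq_shift` the result is isometric on that range. -/
theorem exists_isCayley (hc : S.IsClosed) : ∃ T : H →L[ℂ] H, IsCayley S T := by
  set R := LinearMap.range (shiftMap S Complex.I) with hR
  have : CompleteSpace R := (hS.isClosed_range_shiftMap hc (Or.inl rfl)).completeSpace_coe
  have hinj : Function.Injective (shiftMap S Complex.I) := by
    rw [injective_iff_map_eq_zero]
    intro p hp
    have := hS.norm_le_shiftMap (Or.inl rfl) p
    rw [hp, norm_zero] at this
    exact norm_le_zero_iff.1 this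
  let E := LinearEquiv.ofInjective (shiftMap S Complex.I) hinj
  have hE : ∀ y : R, ‖shiftMap S (-Complex.I) (E.symm y)‖ = ‖y‖ := by
    intro y
    obtain ⟨p, rfl⟩ := E.surjective y
    rw [E.symm_apply_apply]
    change _ = ‖shiftMap S Complex.I p‖
    rw [shiftMap_apply, shiftMap_apply]
    refine (sq_eq_sq₀ (norm_nonneg _) (norm_nonneg _)).1 ?_
    rw [hS.norm_sq_shift p.2 (Or.inl rfl), hS.norm_sq_shift p.2 (Or.inr rfl)]
  let T0 : R →L[ℂ] H := ((shiftMap S (-Complex.I)).comp E.symm.toLinearMap).mkContinuous 1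
    fun y => by rw [one_mul]; exact (hE y).le
  refine ⟨T0.comp R.orthogonalProjectionOnto, ?_, ?_⟩
  · intro u v h
    have hy : v + Complex.I • u = ((E ⟨(u, v), h⟩ : R) : H) := rfl
    rw [hy, ContinuousLinearMap.comp_apply,
      Submodule.orthogonalProjectionOnto_mem_subspace_eq_self]
    change shiftMap S (-Complex.I) (E.symm (E ⟨(u, v), h⟩)) = _
    rw [E.symm_apply_apply, shiftMap_apply]
    simp [sub_eq_add_neg]
  · intro n hn
    rw [← hS.orthogonal_range_shiftMap (Or.inl rfl)] at hn
    rw [ContinuousLinearMap.comp_apply,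
      Submodule.orthogonalProjectionOnto_eq_zero_iff.2 hn, map_zero]

end IsDenselySymmetric

namespace IsCayley

variable {S : H →ₗ.[ℂ] H} {T : H →L[ℂ] H}

theorem adjoint_map_defect (hT : IsCayley S T) (hS : IsDenselySymmetric S) (hc : S.IsClosed) {m : H}
    (hm : m ∈ defectSpace S (-Complex.I)) : ContinuousLinearMap.adjoint T m = 0 := by
  refine ext_inner_left ℂ fun z => ?_
  rw [ContinuousLinearMap.adjoint_inner_right, inner_zero_right]
  obtain ⟨u, v, n, h, hn, rfl⟩ := hS.exists_shift_add_defect hc (Or.inl rfl) z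
  rw [map_add, hT.map_shift h, hT.map_defect hn, add_zero]
  have := hS.inner_shift_defect (Or.inr rfl) h hm
  rwa [neg_smul, ← sub_eq_add_neg] at this

theorem adjoint_map_shift (hT : IsCayley S T) (hS : IsDenselySymmetric S) (hc : S.IsClosed)
    {u v : H} (h : (u, v) ∈ S.graph) :
    ContinuousLinearMap.adjoint T (v - Complex.I • u) = v + Complex.I • u := by
  refine ext_inner_left ℂ fun z => ?_
  rw [ContinuousLinearMap.adjoint_inner_right]
  obtain ⟨u', v', n, h', hn, rfl⟩ := hS.exists_shift_add_defect hc (Or.inl rfl) z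
  have h0 := hS.inner_shift_defect (Or.inl rfl) h hn
  rw [map_add, hT.map_shift h', hT.map_defect hn, add_zero, hS.inner_cayley h' h,
    inner_add_left (_ + _) n, ← inner_conj_symm n, h0, map_zero, add_zero]

theorem adjoint_apply_apply (hT : IsCayley S T) (hS : IsDenselySymmetric S) (hc : S.IsClosed)
    {x : H} (hx : ∀ n ∈ defectSpace S Complex.I, inner ℂ n x = 0) :
    ContinuousLinearMap.adjoint T (T x) = x := by
  obtain ⟨u, v, h, rfl⟩ := hS.exists_shift_of_orthogonal hc (Or.inl rfl) hx
  rw [hT.map_shift h, hT.adjoint_map_shift hS hc h]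

theorem apply_adjoint_apply (hT : IsCayley S T) (hS : IsDenselySymmetric S) (hc : S.IsClosed)
    {x : H} (hx : ∀ m ∈ defectSpace S (-Complex.I), inner ℂ m x = 0) :
    T (ContinuousLinearMap.adjoint T x) = x := by
  obtain ⟨u, v, h, rfl⟩ := hS.exists_shift_of_orthogonal hc (Or.inr rfl) hx
  have e : v + -Complex.I • u = v - Complex.I • u := by rw [neg_smul, sub_eq_add_neg]
  rw [e, hT.adjoint_map_shift hS hc h, hT.map_shift h]

/-- A bounded operator commuting with the Cayley transform and its adjoint preserves `S`. -/
theorem map_mem_graph (hT : IsCayley S T) (hS : IsDenselySymmetric S) (hc : S.IsClosed)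
    {R : H →L[ℂ] H} (hRT : ∀ x, R (T x) = T (R x))
    (hRT' : ∀ x, R (ContinuousLinearMap.adjoint T x) = ContinuousLinearMap.adjoint T (R x))
    {u v : H} (h : (u, v) ∈ S.graph) : (R u, R v) ∈ S.graph := by
  set x := v + Complex.I • u with hx
  have hTx : T x = v - Complex.I • u := hT.map_shift h
  have hxx : ContinuousLinearMap.adjoint T (T x) = x := by
    rw [hTx, hT.adjoint_map_shift hS hc h]
  -- Rx = R T*T x = T* R T x lies in the range of T*, hence is orthogonal to N_i = ker T and belongs
  -- to ran(S + i).
  obtain ⟨u', v', h', e⟩ : ∃ u' v', (u', v') ∈ S.graph ∧ R x = v' + Complex.I • u' := by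
    refine hS.exists_shift_of_orthogonal hc (Or.inl rfl) fun n hn => ?_
    rw [← hxx, hRT', ContinuousLinearMap.adjoint_inner_right, hT.map_defect hn, inner_zero_left]
  have e2 : R (v - Complex.I • u) = v' - Complex.I • u' := by
    rw [← hTx, hRT, e, hT.map_shift h']
  have hv : R v = v' := by
    have h2 : v = (1 / 2 : ℂ) • (x + (v - Complex.I • u)) := by rw [hx]; module
    rw [h2, map_smul, map_add, e, e2]; module
  have hu : R u = u' := by
    have h2 : u = (-Complex.I / 2 : ℂ) • (x - (v - Complex.I • u)) := by
      rw [hx]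
      match_scalars
      · linear_combination (1 : ℂ) * Complex.I_mul_I
      · ring
    rw [h2, map_smul, map_sub, e, e2]
    match_scalars
    · ring
    · linear_combination (-1 : ℂ) * Complex.I_mul_I
  rw [hu, hv]
  exact h'

/-- The Cayley transform commutes with bounded operators preserving `S` and its defect space. -/
theorem commute_of_map_mem (hT : IsCayley S T) (hS : IsDenselySymmetric S) (hc : S.IsClosed)
    {R : H →L[ℂ] H} (hR : ∀ u v, (u, v) ∈ S.graph → (R u, R v) ∈ S.graph)
    (hRn : ∀ n ∈ defectSpace S Complex.I, R n ∈ defectSpace S Complex.I) (x : H) :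
    R (T x) = T (R x) := by
  obtain ⟨u, v, n, h, hn, rfl⟩ := hS.exists_shift_add_defect hc (Or.inl rfl) x
  have := hT.map_shift (hR _ _ h)
  rw [map_add T, hT.map_shift h, hT.map_defect hn, add_zero, map_add R _ n, map_add T,
    hT.map_defect (hRn n hn), map_add R, map_smul R, this]
  simp

end IsCayley

end KreinExt

/-! ### Consequences of a vanishing characteristic function. -/

namespace KreinExt

variable {H : Type*} [NormedAddCommGroup H] [InnerProductSpace ℂ H]

/-- If the resolvent equation `w - ε B w = n` has solutions orthogonal to `y` for all small `ε`,
then `y` is orthogonal to all `Bᵏ n`. -/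
theorem inner_pow_apply_eq_zero (B : H →L[ℂ] H) (n y : H)
    (h : ∀ ε : ℝ, 0 < ε → ε < 1 → ∃ w, w - (ε : ℂ) • B w = n ∧ inner ℂ y w = 0) (k : ℕ) :
    inner ℂ y ((B ^ k) n) = 0 := by
  induction k using Nat.strong_induction_on with
  | _ k ih =>
  set M : ℝ := ‖y‖ * (‖B ^ (k + 1)‖ * (2 * ‖n‖)) with hM
  have hM0 : 0 ≤ M := by positivity
  -- Iterating w = n + εBw gives w = Σ_{i≤k} εⁱBⁱn + εᵏ⁺¹Bᵏ⁺¹w. Paired with y, the terms i < k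
  -- vanish by induction, and ε‖B‖ ≤ 1/2 bounds ‖w‖ by 2‖n‖.
  have hle : ∀ ε : ℝ, 0 < ε → ε < 1 → ε * ‖B‖ ≤ 1 / 2 → ‖inner ℂ y ((B ^ k) n)‖ ≤ ε * M := by
    intro ε h0 h1 hB
    obtain ⟨w, hw, hy⟩ := h ε h0 h1
    have hwn : ‖w‖ ≤ 2 * ‖n‖ := by
      have e : w = n + (ε : ℂ) • B w := by rw [← hw]; abel
      have h2 : ‖w‖ ≤ ‖n‖ + ε * (‖B‖ * ‖w‖) := by
        conv_lhs => rw [e]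
        refine (norm_add_le _ _).trans (add_le_add le_rfl ?_)
        rw [norm_smul, Complex.norm_real, Real.norm_of_nonneg h0.le]
        exact mul_le_mul_of_nonneg_left (B.le_opNorm w) h0.le
      nlinarith [norm_nonneg w]
    have hiter : ∀ j, w = ∑ i ∈ Finset.range j, ((ε : ℂ) ^ i) • (B ^ i) n
        + ((ε : ℂ) ^ j) • (B ^ j) w := by
      intro j
      induction j with
      | zero => simp
      | succ j ihj =>
        have e : w = n + (ε : ℂ) • B w := by rw [← hw]; abel
        have e2 : (B ^ j) w = (B ^ j) n + (ε : ℂ) • (B ^ (j + 1)) w := by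
          conv_lhs => rw [e]
          rw [map_add, map_smul, pow_succ]
          rfl
        conv_lhs => rw [ihj, e2]
        rw [Finset.sum_range_succ, smul_add, smul_smul, ← pow_succ, add_assoc]
    have h3 : inner ℂ y w = (ε : ℂ) ^ k * (inner ℂ y ((B ^ k) n)
        + ε * inner ℂ y ((B ^ (k + 1)) w)) := by
      conv_lhs => rw [hiter (k + 1)]
      rw [inner_add_right, inner_sum, Finset.sum_range_succ, Finset.sum_eq_zero, inner_smul_right,
        inner_smul_right]
      · ring
      · intro i hi
        rw [inner_smul_right, ih i (Finset.mem_range.1 hi), mul_zero]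
    rw [hy] at h3
    have hε : (ε : ℂ) ≠ 0 := Complex.ofReal_ne_zero.2 h0.ne'
    have h4 := (mul_eq_zero.1 h3.symm).resolve_left (pow_ne_zero _ hε)
    rw [eq_neg_of_add_eq_zero_left h4, norm_neg, norm_mul, Complex.norm_real,
      Real.norm_of_nonneg h0.le]
    refine mul_le_mul_of_nonneg_left ((norm_inner_le_norm _ _).trans ?_) h0.le
    refine mul_le_mul_of_nonneg_left (((B ^ (k + 1)).le_opNorm w).trans ?_) (norm_nonneg _)
    exact mul_le_mul_of_nonneg_left hwn (norm_nonneg _)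
  -- If the inner product had absolute value a > 0, then ε = 1/(2(1 + ‖B‖ + M/a)) would be
  -- admissible and give εM < a.
  by_contra hne
  have hpos : 0 < ‖inner ℂ y ((B ^ k) n)‖ := norm_pos_iff.2 hne
  set a := ‖inner ℂ y ((B ^ k) n)‖ with ha
  have hD : 0 < 2 * (1 + ‖B‖ + M / a) := by positivity
  have h1 : (1 / (2 * (1 + ‖B‖ + M / a))) < 1 := by
    rw [div_lt_one hD]
    have : 0 ≤ M / a := by positivity
    nlinarith [norm_nonneg B]
  have h2 := hle _ (one_div_pos.2 hD) h1 (by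
    have : 0 ≤ M / a := by positivity
    rw [one_div, inv_mul_le_iff₀ hD]
    nlinarith [norm_nonneg B])
  rw [one_div, le_inv_mul_iff₀ hD] at h2
  have h5 : M / a * a = M := div_mul_cancel₀ _ hpos.ne'
  nlinarith [norm_nonneg B, mul_nonneg (norm_nonneg B) hpos.le]

variable [CompleteSpace H]

theorem mem_graph_dissipativeExt {S : H →ₗ.[ℂ] H} {μ : ℂ} {x y : H} :
    (x, y) ∈ (dissipativeExt S μ).graph ↔
      x ∈ S.domain ⊔ defectSpace S μ ∧ (x, y) ∈ S.adjoint.graph :=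
  mem_graph_domRestrict

namespace IsDenselySymmetric

variable {S : H →ₗ.[ℂ] H} (hS : IsDenselySymmetric S)

include hS

theorem exists_of_mem_dissipativeExt {μ : ℂ} {x y : H}
    (h : (x, y) ∈ (dissipativeExt S μ).graph) :
    ∃ s t m, (s, t) ∈ S.graph ∧ m ∈ defectSpace S μ ∧ x = s + m ∧ y = t + μ • m := by
  obtain ⟨hx, hxy⟩ := mem_graph_dissipativeExt.1 h
  obtain ⟨s, hs, m, hm, rfl⟩ := Submodule.mem_sup.1 hx
  have hst : (s, S ⟨s, hs⟩) ∈ S.graph := mem_graph_iff_exists.2 ⟨hs, rfl⟩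
  refine ⟨s, _, m, hst, hm, rfl, ?_⟩
  exact LinearPMap.mem_graph_snd_inj _ hxy
    (graph_add (hS.mem_adjoint_of_mem hst) (mem_defectSpace.1 hm)) rfl

/-- A_μ is dissipative: Im (A_μ x, x) = Im μ · ‖m‖² ≥ 0, with m the N_μ component of x. The
eigenvalue -i would make it -‖x‖². -/
theorem dissipativeExt_injective {μ : ℂ} (hμ : 0 < μ.im) (x : H)
    (h : (x, (0 : H)) ∈ (subScalar (dissipativeExt S μ) (-Complex.I)).graph) : x = 0 := by
  rw [mem_graph_subScalar, zero_add] at h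
  obtain ⟨s, t, m, hst, hm, hx, hy⟩ := hS.exists_of_mem_dissipativeExt h
  have h1 : (inner ℂ x (-Complex.I • x)).im = -‖x‖ ^ 2 := by
    rw [inner_smul_right, inner_self_eq_norm_sq_to_K]
    simp [← Complex.ofReal_pow]
  have h2 : 0 ≤ (inner ℂ x (-Complex.I • x)).im := by
    rw [hy, hx]
    have h3 := hS.mem_defect_iff.1 hm s t hst
    have h4 : inner ℂ m t = (starRingEnd ℂ) (μ * inner ℂ s m) := by
      rw [← h3, inner_conj_symm]
    have h5 : (inner ℂ s t).im = 0 := by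
      have := inner_conj_symm (𝕜 := ℂ) s t
      rw [hS.symm hst hst] at this
      exact Complex.conj_eq_iff_im.1 this
    rw [inner_add_left, inner_add_right, inner_add_right, inner_smul_right, inner_smul_right, h4,
      inner_self_eq_norm_sq_to_K]
    simp only [Complex.add_im, Complex.conj_im, h5, Complex.coe_algebraMap, ← Complex.ofReal_pow,
      Complex.mul_im, Complex.ofReal_re, Complex.ofReal_im]
    nlinarith [mul_nonneg hμ.le (sq_nonneg ‖m‖)]
  have : ‖x‖ ^ 2 = 0 := by nlinarith [sq_nonneg ‖x‖]
  simpa using this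

/-- If the characteristic function vanishes at `μ`, then `N_i ⊆ D(S) + N_μ`. -/
theorem exists_of_charFunction_eq_zero {μ : ℂ} (hμ : 0 < μ.im)
    (h : charFunction S μ = (0 : H →ₗ[ℂ] H).toPMap (defectSpace S Complex.I)) {n : H}
    (hn : n ∈ defectSpace S Complex.I) :
    ∃ s t, (s, t) ∈ S.graph ∧ t - μ • s = (Complex.I - μ) • n := by
  have h0 : (n, (0 : H)) ∈ (charFunction S μ).graph := by
    rw [h]
    exact mem_graph_iff_exists.2 ⟨hn, rfl⟩
  obtain ⟨y, hy, hy'⟩ := mem_graph_opMul.1 (mem_graph_domRestrict.1 h0).2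
  rw [mem_graph_inverse (hS.dissipativeExt_injective hμ), mem_graph_subScalar] at hy
  rw [mem_graph_subScalar, zero_add] at hy'
  -- Here y = (A_μ + i)⁻¹n satisfies (A_μ - i)y = 0, so n = 2iy; both sides are A_μ y.
  have e : n + -Complex.I • y = Complex.I • y := LinearPMap.mem_graph_snd_inj _ hy hy' rfl
  obtain ⟨s, t, m, hst, hm, hys, hyt⟩ := hS.exists_of_mem_dissipativeExt hy'
  have e1 : n = (2 * Complex.I) • y := by
    rw [eq_sub_of_add_eq e]; module
  refine ⟨(2 * Complex.I) • s, (2 * Complex.I) • t, graph_smul _ hst, ?_⟩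
  have e2 : t = Complex.I • y - μ • m := by rw [hyt]; abel
  rw [e1, e2, hys]
  module

/-- If the characteristic function of `S` vanishes, then `N_{-i}` is orthogonal to all `T*ᵏ N_i`. -/
theorem inner_defect_pow_adjoint_cayley (hc : S.IsClosed) (hSh : HasZeroCharFunction S)
    {T : H →L[ℂ] H} (hT : IsCayley S T) {n m : H} (hn : n ∈ defectSpace S Complex.I)
    (hm : m ∈ defectSpace S (-Complex.I)) (k : ℕ) :
    inner ℂ m ((ContinuousLinearMap.adjoint T ^ k) n) = 0 := by
  refine inner_pow_apply_eq_zero _ _ _ (fun ε h0 h1 => ?_) k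
  have h1' : (1 - ε : ℂ) ≠ 0 := by
    rw [sub_ne_zero]; exact_mod_cast h1.ne'
  set n' := (Complex.I / 2) • n with hn'
  have hnn : n = (-2 * Complex.I) • n' := by
    rw [hn', smul_smul]
    have : -2 * Complex.I * (Complex.I / 2) = 1 := by linear_combination -Complex.I_mul_I
    rw [this, one_smul]
  have hn'mem : n' ∈ defectSpace S Complex.I := Submodule.smul_mem _ _ hn
  -- The point μ = i(1 + ε)/(1 - ε) is the one with (μ - i)/(μ + i) = ε.
  have hμ : Complex.I * ((1 + ε) / (1 - ε)) = (((1 + ε) / (1 - ε) : ℝ) : ℂ) * Complex.I := by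
    push_cast; ring
  have him : 0 < (Complex.I * ((1 + ε) / (1 - ε)) : ℂ).im := by
    rw [hμ, Complex.im_ofReal_mul, Complex.I_im, mul_one]
    exact div_pos (by linarith) (by linarith)
  obtain ⟨s, t, hst, e⟩ := hS.exists_of_charFunction_eq_zero him (hSh _ him) hn'mem
  have e' : (1 - ε : ℂ) • t - (Complex.I * (1 + ε)) • s = (-2 * Complex.I * ε) • n' := by
    have := congrArg (fun z => (1 - ε : ℂ) • z) e
    simp only [smul_sub, smul_smul] at this
    convert this using 2
    · congr 1; field_simp
    · field_simp; ring
  set x := t + Complex.I • s with hx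
  have hTx : T x = (ε : ℂ) • (x - (2 * Complex.I) • n') := by
    rw [hx, hT.map_shift hst, ← sub_eq_zero]
    have : t - Complex.I • s - (ε : ℂ) • (t + Complex.I • s - (2 * Complex.I) • n')
      = (1 - ε : ℂ) • t - (Complex.I * (1 + ε)) • s - (-2 * Complex.I * ε) • n' := by module
    rw [this, e', sub_self]
  have hTTx : ContinuousLinearMap.adjoint T (T x) = x := by
    rw [hx, hT.map_shift hst, hT.adjoint_map_shift hS hc hst]
  -- With w = x - 2i n' one has Tx = εw. Then εT*w = T*Tx = x gives the resolvent equation, and T*m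
  -- = 0 gives w ⊥ m.
  refine ⟨x - (2 * Complex.I) • n', ?_, ?_⟩
  · rw [← map_smul, ← hTx, hTTx, hnn]
    module
  · have h2 : inner ℂ m (T x) = 0 := by
      rw [← ContinuousLinearMap.adjoint_inner_left, hT.adjoint_map_defect hS hc hm, inner_zero_left]
    rw [hTx, inner_smul_right] at h2
    exact (mul_eq_zero.1 h2).resolve_left (Complex.ofReal_ne_zero.2 h0.ne')

end IsDenselySymmetric

end KreinExt

/-! ### Simplicity, and the defect spaces of the parts of S. -/

namespace KreinExt

variable {H : Type*} [NormedAddCommGroup H] [InnerProductSpace ℂ H]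

theorem dense_part_domain {S : H →ₗ.[ℂ] H} (hS : IsDenselySymmetric S) (K : Submodule ℂ H)
    (P : H →L[ℂ] H) (hPK : ∀ x, P x ∈ K) (hP : ∀ x ∈ K, P x = x)
    (hPS : ∀ u v, (u, v) ∈ S.graph → (P u, P v) ∈ S.graph) :
    Dense ((part S K).domain : Set K) := by
  have hs : Function.Surjective fun x : H => (⟨P x, hPK x⟩ : K) :=
    fun y => ⟨y, Subtype.ext (hP y y.2)⟩
  have hcont : Continuous fun x : H => (⟨P x, hPK x⟩ : K) := P.continuous.subtype_mk _
  refine (hs.denseRange.dense_image hcont hS.dense).mono ?_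
  rintro _ ⟨u, hu, rfl⟩
  have h : (u, S ⟨u, hu⟩) ∈ S.graph := mem_graph_iff_exists.2 ⟨hu, rfl⟩
  have h2 : ((⟨P u, hPK u⟩ : K), (⟨P _, hPK _⟩ : K)) ∈ (part S K).graph :=
    mem_graph_part.2 (hPS _ _ h)
  exact (mem_graph_iff_exists.1 h2).1

variable [CompleteSpace H]

/-- A simple symmetric operator has no nonzero subspace orthogonal to both defect spaces that reduces
its Cayley transform. -/
theorem IsCayley.eq_bot_of_isSimple {S : H →ₗ.[ℂ] H} {T : H →L[ℂ] H} (hT : IsCayley S T)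
    (hS : IsDenselySymmetric S) (hc : S.IsClosed) (hsimple : IsSimple S) (K : Submodule ℂ H)
    [CompleteSpace K] (hKn : ∀ x ∈ K, ∀ n ∈ defectSpace S Complex.I, inner ℂ n x = 0)
    (hKm : ∀ x ∈ K, ∀ m ∈ defectSpace S (-Complex.I), inner ℂ m x = 0)
    (hKT : ∀ x ∈ K, T x ∈ K) (hKT' : ∀ x ∈ K, ContinuousLinearMap.adjoint T x ∈ K) : K = ⊥ := by
  have hmem : ∀ u v : H, v + Complex.I • u ∈ K → v - Complex.I • u ∈ K → u ∈ K ∧ v ∈ K := by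
    intro u v h1 h2
    constructor
    · have : u = (-Complex.I / 2) • ((v + Complex.I • u) - (v - Complex.I • u)) := by
        match_scalars
        · linear_combination Complex.I_mul_I
        · ring
      rw [this]
      exact K.smul_mem _ (K.sub_mem h1 h2)
    · have : v = (1 / 2 : ℂ) • ((v + Complex.I • u) + (v - Complex.I • u)) := by module
      rw [this]
      exact K.smul_mem _ (K.add_mem h1 h2)
  -- The part of S in K has full ranges at both i and -i. Together with symmetry this yields first
  -- density of its domain, then self-adjointness.
  have hplus : ∀ x : K, ∃ u v : K, (u, v) ∈ (part S K).graph ∧ x = v + Complex.I • u := by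
    rintro ⟨x, hx⟩
    obtain ⟨u, v, h, rfl⟩ := hS.exists_shift_of_orthogonal hc (Or.inl rfl) (hKn x hx)
    have h2 := hKT _ hx
    rw [hT.map_shift h] at h2
    obtain ⟨hu, hv⟩ := hmem u v hx h2
    exact ⟨⟨u, hu⟩, ⟨v, hv⟩, mem_graph_part.2 h, rfl⟩
  have hminus : ∀ x : K, ∃ u v : K, (u, v) ∈ (part S K).graph ∧ x = v - Complex.I • u := by
    rintro ⟨x, hx⟩
    obtain ⟨u, v, h, e⟩ := hS.exists_shift_of_orthogonal hc (Or.inr rfl) (hKm x hx)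
    rw [neg_smul, ← sub_eq_add_neg] at e
    subst e
    have h2 := hKT' _ hx
    rw [hT.adjoint_map_shift hS hc h] at h2
    obtain ⟨hu, hv⟩ := hmem u v h2 hx
    exact ⟨⟨u, hu⟩, ⟨v, hv⟩, mem_graph_part.2 h, rfl⟩
  have hsymm : ∀ {u v u' v' : K}, (u, v) ∈ (part S K).graph → (u', v') ∈ (part S K).graph →
      inner ℂ v u' = inner ℂ u v' :=
    fun h h' => hS.symm (mem_graph_part.1 h) (mem_graph_part.1 h')
  have hdense : Dense ((part S K).domain : Set K) := by
    rw [Submodule.dense_iff_topologicalClosure_eq_top, Submodule.topologicalClosure_eq_top_iff,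
      Submodule.eq_bot_iff]
    intro k hk
    rw [Submodule.mem_orthogonal] at hk
    obtain ⟨u, v, h, rfl⟩ := hplus k
    obtain ⟨u', v', h', e⟩ := hminus u
    have h0 := hk u' (mem_graph_iff_exists.1 h').1
    have hu : u = 0 := by
      rw [← inner_self_eq_zero (𝕜 := ℂ)]
      have e2 : inner ℂ u u = inner ℂ (v' - Complex.I • u') u := by rw [← e]
      rw [e2, inner_sub_left, inner_smul_left, hsymm h' h, Complex.conj_I]
      rw [inner_add_right, inner_smul_right] at h0
      linear_combination h0
    subst hu
    rw [LinearPMap.graph_fst_eq_zero_snd _ h rfl]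
    simp
  refine hsimple K (LinearPMap.isSelfAdjoint_def.2 (graph_ext fun x y => ?_))
  rw [mem_graph_adjoint hdense]
  constructor
  · intro hxy
    obtain ⟨u, v, h, e⟩ := hplus (y + Complex.I • x)
    obtain ⟨u', v', h', e'⟩ := hminus (x - u)
    have hy : y = v - Complex.I • (x - u) := by
      rw [eq_sub_of_add_eq e]; module
    -- The vector x - u lies in the kernel of the adjoint plus i, hence is orthogonal to the range
    -- of the part minus i, which is all of K.
    have h0 : x - u = 0 := by
      rw [← inner_self_eq_zero (𝕜 := ℂ)]
      have e2 : inner ℂ (x - u) (x - u) = inner ℂ (v' - Complex.I • u') (x - u) := by rw [← e']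
      have h1 := hxy _ _ h'
      have h2 := hsymm h' h
      rw [hy, inner_sub_right, inner_smul_right] at h1
      rw [e2, inner_sub_left, inner_smul_left, Complex.conj_I, inner_sub_right v', h1, h2]
      ring
    rw [h0, smul_zero, sub_zero] at hy
    rw [hy, sub_eq_zero.1 h0]
    exact h
  · intro hxy u v huv
    exact hsymm huv hxy

section Part

variable {S : H →ₗ.[ℂ] H} (hS : IsDenselySymmetric S) (K : Submodule ℂ H)
  (P : H →L[ℂ] H) (hPK : ∀ x, P x ∈ K) (hP : ∀ x ∈ K, P x = x)
  (hPS : ∀ u v, (u, v) ∈ S.graph → (P u, P v) ∈ S.graph)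
  (hPi : ∀ x, ∀ y ∈ K, inner ℂ (P x) y = inner ℂ x y)

include hS hPK hP hPS hPi

/-- P is the orthogonal projection onto K and preserves S, so testing x against the graph of S or
only against its projection to K gives the same inner products. -/
theorem mem_defectSpace_part [CompleteSpace K] {μ : ℂ} {x : K} :
    x ∈ defectSpace (part S K) μ ↔ (x : H) ∈ defectSpace S μ := by
  rw [mem_defectSpace, mem_graph_adjoint (dense_part_domain hS K P hPK hP hPS), hS.mem_defect_iff]
  constructor
  · intro h u v huv
    have := h ⟨P u, hPK u⟩ ⟨P v, hPK v⟩ (mem_graph_part.2 (hPS u v huv))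
    rw [Submodule.coe_inner, Submodule.coe_inner, Submodule.coe_smul, inner_smul_right] at this
    rwa [hPi v _ x.2, hPi u _ x.2] at this
  · intro h u v huv
    rw [Submodule.coe_inner, Submodule.coe_inner, Submodule.coe_smul, inner_smul_right]
    exact h _ _ (mem_graph_part.1 huv)

end Part

namespace FundamentalSymmetry

variable (J : FundamentalSymmetry H)

theorem inner_op_left (x y : H) : inner ℂ (J.op x) y = inner ℂ x (J.op y) := by
  rw [← ContinuousLinearMap.adjoint_inner_right,
    ContinuousLinearMap.isSelfAdjoint_iff'.1 J.isSelfAdjoint]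

variable {S : H →ₗ.[ℂ] H} (hS : IsDenselySymmetric S) (hSJ : Commutes S J.op)

include hS hSJ

theorem mem_defectSpace_plus {μ : ℂ} {x : J.plus} :
    x ∈ defectSpace (part S J.plus) μ ↔ (x : H) ∈ defectSpace S μ := by
  refine mem_defectSpace_part hS J.plus ((1 / 2 : ℂ) • (1 + J.op)) (fun x => ⟨x, rfl⟩)
    (fun x hx => ?_) (fun u v h => ?_) (fun x y hy => ?_)
  · simp only [smul_apply, add_apply, one_apply_eq_self, (J.mem_plus x).1 hx]
    module
  · exact graph_smul _ (graph_add h (hSJ.mem_graph h))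
  · simp only [smul_apply, add_apply, one_apply_eq_self, inner_smul_left, inner_add_left,
      J.inner_op_left, (J.mem_plus y).1 hy]
    rw [map_div₀, map_one, map_ofNat]
    ring

theorem mem_defectSpace_minus {μ : ℂ} {x : J.minus} :
    x ∈ defectSpace (part S J.minus) μ ↔ (x : H) ∈ defectSpace S μ := by
  refine mem_defectSpace_part hS J.minus ((1 / 2 : ℂ) • (1 - J.op)) (fun x => ⟨x, rfl⟩)
    (fun x hx => ?_) (fun u v h => ?_) (fun x y hy => ?_)
  · simp only [smul_apply, sub_apply, one_apply_eq_self, (J.mem_minus x).1 hx]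
    module
  · exact graph_smul _ (graph_sub h (hSJ.mem_graph h))
  · simp only [smul_apply, sub_apply, one_apply_eq_self, inner_smul_left, inner_sub_left,
      J.inner_op_left, (J.mem_minus y).1 hy, inner_neg_right]
    rw [map_div₀, map_one, map_ofNat]
    ring

theorem adjoint_graph_map {x y : H} (h : (x, y) ∈ S.adjoint.graph) :
    (J.op x, J.op y) ∈ S.adjoint.graph := by
  refine hS.adjoint_map_mem (fun u v huv => ?_) h
  rw [ContinuousLinearMap.isSelfAdjoint_iff'.1 J.isSelfAdjoint]
  exact hSJ.mem_graph huv

theorem map_defect {μ : ℂ} {x : H} (h : x ∈ defectSpace S μ) : J.op x ∈ defectSpace S μ := by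
  rw [mem_defectSpace] at h ⊢
  rw [← map_smul]
  exact J.adjoint_graph_map hS hSJ h

/-- A defect space is the sum of the defect spaces of the parts of `S`. -/
theorem exists_of_mem_defect {μ : ℂ} {a : J.plus} {b : J.minus}
    (ha : Submodule.span ℂ {a} = defectSpace (part S J.plus) μ)
    (hb : Submodule.span ℂ {b} = defectSpace (part S J.minus) μ) {x : H}
    (hx : x ∈ defectSpace S μ) : ∃ c d : ℂ, x = c • (a : H) + d • (b : H) := by
  have hJx := J.map_defect hS hSJ hx
  set p : J.plus := ⟨(1 / 2 : ℂ) • (x + J.op x), ⟨x, rfl⟩⟩ with hp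
  set m : J.minus := ⟨(1 / 2 : ℂ) • (x - J.op x), ⟨x, rfl⟩⟩ with hm
  have hpd : p ∈ Submodule.span ℂ {a} := by
    rw [ha, J.mem_defectSpace_plus hS hSJ]
    exact Submodule.smul_mem _ _ (Submodule.add_mem _ hx hJx)
  have hmd : m ∈ Submodule.span ℂ {b} := by
    rw [hb, J.mem_defectSpace_minus hS hSJ]
    exact Submodule.smul_mem _ _ (Submodule.sub_mem _ hx hJx)
  obtain ⟨c, hc⟩ := Submodule.mem_span_singleton.1 hpd
  obtain ⟨d, hd⟩ := Submodule.mem_span_singleton.1 hmd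
  refine ⟨c, d, ?_⟩
  rw [← Submodule.coe_smul, ← Submodule.coe_smul, hc, hd, hp, hm]
  module

end FundamentalSymmetry

theorem exists_span_eq_of_finrank_eq_one {E : Type*} [NormedAddCommGroup E] [InnerProductSpace ℂ E]
    {N : Submodule ℂ E} (h : Module.finrank ℂ N = 1) :
    ∃ x : E, ‖x‖ = 1 ∧ Submodule.span ℂ {x} = N := by
  obtain ⟨v, hv, hspan⟩ := finrank_eq_one_iff'.1 h
  have hv' : (v : E) ≠ 0 := fun h0 => hv (Subtype.ext h0)
  have hn : (‖(v : E)‖ : ℂ) ≠ 0 := by exact_mod_cast norm_ne_zero_iff.2 hv'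
  refine ⟨(‖(v : E)‖ : ℂ)⁻¹ • (v : E), norm_smul_inv_norm (𝕜 := ℂ) hv', ?_⟩
  rw [Submodule.span_singleton_smul_eq (isUnit_iff_ne_zero.2 (inv_ne_zero hn))]
  apply le_antisymm
  · rw [Submodule.span_singleton_le_iff_mem]
    exact v.2
  · intro w hw
    obtain ⟨c, hc⟩ := hspan ⟨w, hw⟩
    exact Submodule.mem_span_singleton.2 ⟨c, congrArg Subtype.val hc⟩

theorem exists_defectBasis {J : FundamentalSymmetry H} {S : H →ₗ.[ℂ] H}
    (hp : HasDeficiencyIndicesOne (part S J.plus)) (hm : HasDeficiencyIndicesOne (part S J.minus)) :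
    Nonempty (DefectBasis J S) := by
  obtain ⟨a, ha, ha'⟩ := exists_span_eq_of_finrank_eq_one hp.1
  obtain ⟨b, hb, hb'⟩ := exists_span_eq_of_finrank_eq_one hp.2
  obtain ⟨c, hc, hc'⟩ := exists_span_eq_of_finrank_eq_one hm.1
  obtain ⟨d, hd, hd'⟩ := exists_span_eq_of_finrank_eq_one hm.2
  exact ⟨⟨a, c, b, d, ha', hc', hb', hd', by rw [hc, ha], by rw [hb, ha], by rw [hd, ha]⟩⟩

theorem DefectBasis.epp_ne_zero {J : FundamentalSymmetry H} {S : H →ₗ.[ℂ] H} (e : DefectBasis J S)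
    (hp : HasDeficiencyIndicesOne (part S J.plus)) : (e.epp : H) ≠ 0 := by
  intro h
  have h1 := hp.1
  rw [← e.span_epp, show e.epp = 0 from Subtype.ext h] at h1
  rw [Submodule.span_zero_singleton, finrank_bot] at h1
  exact zero_ne_one h1

end KreinExt

/-! ### The shift model: orbits of the defect vectors and their interchange. -/

namespace KreinExt

variable {H : Type*} [NormedAddCommGroup H] [InnerProductSpace ℂ H] [CompleteSpace H]

theorem inner_pow_right (T : H →L[ℂ] H) (n : ℕ) (x y : H) :
    inner ℂ x ((T ^ n) y) = inner ℂ ((ContinuousLinearMap.adjoint T ^ n) x) y := by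
  rw [← ContinuousLinearMap.star_eq_adjoint, ← star_pow, ContinuousLinearMap.star_eq_adjoint,
    ContinuousLinearMap.adjoint_inner_left]

/-- The orbits of a wandering family under an isometric shift are orthogonal. -/
theorem inner_pow_pow_of_wandering {ι : Type*} (B : H →L[ℂ] H) (f : ι → H)
    (h0 : ∀ s, ContinuousLinearMap.adjoint B (f s) = 0)
    (h1 : ∀ s n, ContinuousLinearMap.adjoint B ((B ^ (n + 1)) (f s)) = (B ^ n) (f s)) (s t : ι)
    (n m : ℕ) :
    inner ℂ ((B ^ n) (f s)) ((B ^ m) (f t)) = if n = m then inner ℂ (f s) (f t) else 0 := by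
  induction n generalizing m with
  | zero =>
    cases m with
    | zero => simp
    | succ m =>
      have : (B ^ (m + 1)) (f t) = B ((B ^ m) (f t)) := by rw [pow_succ']; rfl
      rw [this, ← ContinuousLinearMap.adjoint_inner_left]
      simp [h0]
  | succ n ih =>
    cases m with
    | zero =>
      have : (B ^ (n + 1)) (f s) = B ((B ^ n) (f s)) := by rw [pow_succ']; rfl
      rw [this, ← ContinuousLinearMap.adjoint_inner_right]
      simp [h0]
    | succ m =>
      have : (B ^ (m + 1)) (f t) = B ((B ^ m) (f t)) := by rw [pow_succ']; rfl
      rw [this, ← ContinuousLinearMap.adjoint_inner_left, h1, ih]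
      simp

/-- The sign `± 1` attached to the subspaces `H₊` and `H₋`. -/
def signOf (s : Bool) : ℂ := bif s then 1 else -1

namespace DefectBasis

variable {J : FundamentalSymmetry H} {S : H →ₗ.[ℂ] H} (e : DefectBasis J S)

/-- The vectors of a defect basis, indexed by the signs of `± i` and of `H_±`. -/
def vec : Bool → Bool → H
  | true, true => e.epp
  | true, false => e.epm
  | false, true => e.emp
  | false, false => e.emm

theorem op_vec (k s : Bool) : J.op (e.vec k s) = signOf s • e.vec k s := by
  cases k <;> cases s <;> simp only [vec, signOf, cond_true, cond_false, one_smul, neg_smul]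
  · exact (J.mem_minus _).1 e.emm.2
  · exact (J.mem_plus _).1 e.emp.2
  · exact (J.mem_minus _).1 e.epm.2
  · exact (J.mem_plus _).1 e.epp.2

theorem norm_vec (k s : Bool) : ‖e.vec k s‖ = ‖e.epp‖ := by
  cases k <;> cases s
  · exact e.norm_emm
  · exact e.norm_emp
  · exact e.norm_epm
  · rfl

theorem inner_vec (k s t : Bool) :
    inner ℂ (e.vec k s) (e.vec k t) = if s = t then (‖e.epp‖ : ℂ) ^ 2 else 0 := by
  split_ifs with h
  · subst h
    rw [inner_self_eq_norm_sq_to_K, e.norm_vec]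
    rfl
  · have h1 := J.inner_op_left (e.vec k s) (e.vec k t)
    rw [e.op_vec, e.op_vec, inner_smul_left, inner_smul_right] at h1
    cases s <;> cases t <;> simp [signOf] at h h1 ⊢
    · linear_combination (-1 / 2 : ℂ) * h1
    · linear_combination (1 / 2 : ℂ) * h1

section

variable (hS : IsDenselySymmetric S) (hSJ : Commutes S J.op)

include hS hSJ

theorem vec_true_mem (s : Bool) : e.vec true s ∈ defectSpace S Complex.I := by
  cases s
  · refine (J.mem_defectSpace_minus hS hSJ).1 ?_
    rw [← e.span_epm]
    exact Submodule.mem_span_singleton_self _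
  · refine (J.mem_defectSpace_plus hS hSJ).1 ?_
    rw [← e.span_epp]
    exact Submodule.mem_span_singleton_self _

theorem vec_false_mem (s : Bool) : e.vec false s ∈ defectSpace S (-Complex.I) := by
  cases s
  · refine (J.mem_defectSpace_minus hS hSJ).1 ?_
    rw [← e.span_emm]
    exact Submodule.mem_span_singleton_self _
  · refine (J.mem_defectSpace_plus hS hSJ).1 ?_
    rw [← e.span_emp]
    exact Submodule.mem_span_singleton_self _

theorem exists_of_mem_defect_I {x : H} (hx : x ∈ defectSpace S Complex.I) :
    ∃ c d : ℂ, x = c • e.vec true true + d • e.vec true false :=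
  J.exists_of_mem_defect hS hSJ e.span_epp e.span_epm hx

theorem exists_of_mem_defect_neg_I {x : H} (hx : x ∈ defectSpace S (-Complex.I)) :
    ∃ c d : ℂ, x = c • e.vec false true + d • e.vec false false :=
  J.exists_of_mem_defect hS hSJ e.span_emp e.span_emm hx

end

/-- The orbits of the defect basis under the Cayley transform (from `N_{-i}`) and its adjoint
(from `N_i`). -/
noncomputable def orbit (T : H →L[ℂ] H) (i : Bool × Bool × ℕ) : H :=
  ((bif i.1 then ContinuousLinearMap.adjoint T else T) ^ i.2.2) (e.vec i.1 i.2.1)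

theorem orbit_true (T : H →L[ℂ] H) (s : Bool) (n : ℕ) :
    e.orbit T (true, s, n) = (ContinuousLinearMap.adjoint T ^ n) (e.vec true s) := rfl

theorem orbit_false (T : H →L[ℂ] H) (s : Bool) (n : ℕ) :
    e.orbit T (false, s, n) = (T ^ n) (e.vec false s) := rfl

theorem orbit_zero (T : H →L[ℂ] H) (k s : Bool) : e.orbit T (k, s, 0) = e.vec k s := rfl

theorem adjoint_orbit_true (T : H →L[ℂ] H) (s : Bool) (n : ℕ) :
    ContinuousLinearMap.adjoint T (e.orbit T (true, s, n)) = e.orbit T (true, s, n + 1) := by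
  rw [e.orbit_true, e.orbit_true, pow_succ']
  rfl

theorem apply_orbit_false (T : H →L[ℂ] H) (s : Bool) (n : ℕ) :
    T (e.orbit T (false, s, n)) = e.orbit T (false, s, n + 1) := by
  rw [e.orbit_false, e.orbit_false, pow_succ']
  rfl

end DefectBasis

/-- The situation of a simple `J`-symmetric operator with zero characteristic function: the Cayley
transform of `S` is a backward shift on the orbit of `N_i` and a shift on the orbit of `N_{-i}`. -/
structure IsShiftModel (J : FundamentalSymmetry H) (S : H →ₗ.[ℂ] H) (T : H →L[ℂ] H)
    (e : DefectBasis J S) : Prop where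
  symm : IsDenselySymmetric S
  closed : S.IsClosed
  comm : Commutes S J.op
  simple : IsSimple S
  cayley : IsCayley S T
  epp_ne_zero : (e.epp : H) ≠ 0
  inner_eq_zero : ∀ {n m : H}, n ∈ defectSpace S Complex.I → m ∈ defectSpace S (-Complex.I) →
    ∀ k : ℕ, inner ℂ m ((ContinuousLinearMap.adjoint T ^ k) n) = 0

namespace IsShiftModel

variable {J : FundamentalSymmetry H} {S : H →ₗ.[ℂ] H} {T : H →L[ℂ] H} {e : DefectBasis J S}
  (h : IsShiftModel J S T e)

include h

theorem vec_true_mem (s : Bool) : e.vec true s ∈ defectSpace S Complex.I :=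
  e.vec_true_mem h.symm h.comm s

theorem vec_false_mem (s : Bool) : e.vec false s ∈ defectSpace S (-Complex.I) :=
  e.vec_false_mem h.symm h.comm s

theorem apply_orbit_true_zero (s : Bool) : T (e.orbit T (true, s, 0)) = 0 :=
  h.cayley.map_defect (h.vec_true_mem s)

theorem adjoint_orbit_false_zero (s : Bool) :
    ContinuousLinearMap.adjoint T (e.orbit T (false, s, 0)) = 0 :=
  h.cayley.adjoint_map_defect h.symm h.closed (h.vec_false_mem s)

/-- TT* is the identity off N_{-i}, and the orbit of N_i is orthogonal to N_{-i}; this is where the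
vanishing characteristic function enters. -/
theorem apply_orbit_true_succ (s : Bool) (n : ℕ) :
    T (e.orbit T (true, s, n + 1)) = e.orbit T (true, s, n) := by
  rw [← e.adjoint_orbit_true]
  exact h.cayley.apply_adjoint_apply h.symm h.closed fun m hm =>
    h.inner_eq_zero (h.vec_true_mem s) hm n

theorem adjoint_orbit_false_succ (s : Bool) (n : ℕ) :
    ContinuousLinearMap.adjoint T (e.orbit T (false, s, n + 1)) = e.orbit T (false, s, n) := by
  rw [← e.apply_orbit_false]
  refine h.cayley.adjoint_apply_apply h.symm h.closed fun m hm => ?_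
  rw [e.orbit_false, inner_pow_right, ← inner_conj_symm,
    h.inner_eq_zero hm (h.vec_false_mem s) n, map_zero]

/-- Within one family this is the wandering property. Across families, (Tⁿm, T*ᵏn') = (m, T*ⁿ⁺ᵏn') =
0. -/
theorem inner_orbit (i j : Bool × Bool × ℕ) :
    inner ℂ (e.orbit T i) (e.orbit T j) = if i = j then (‖e.epp‖ : ℂ) ^ 2 else 0 := by
  obtain ⟨k, s, n⟩ := i
  obtain ⟨l, t, m⟩ := j
  have cross : ∀ s t n m, inner ℂ (e.orbit T (false, s, n)) (e.orbit T (true, t, m)) = 0 := by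
    intro s t n m
    rw [e.orbit_false, e.orbit_true, ← inner_conj_symm, inner_pow_right, inner_conj_symm,
      ← mul_apply_eq_comp, ← pow_add,
      h.inner_eq_zero (h.vec_true_mem t) (h.vec_false_mem s)]
  cases k <;> cases l
  · rw [e.orbit_false, e.orbit_false, inner_pow_pow_of_wandering T (e.vec false)
      (fun s => h.adjoint_orbit_false_zero s) (fun s n => h.adjoint_orbit_false_succ s n),
      e.inner_vec]
    by_cases h1 : s = t <;> by_cases h2 : n = m <;> simp [h1, h2]
  · rw [cross]; simp
  · rw [← inner_conj_symm, cross]; simp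
  · rw [e.orbit_true, e.orbit_true, inner_pow_pow_of_wandering (ContinuousLinearMap.adjoint T)
      (e.vec true) (fun s => by
        rw [ContinuousLinearMap.adjoint_adjoint]; exact h.apply_orbit_true_zero s)
      (fun s n => by
        rw [ContinuousLinearMap.adjoint_adjoint]; exact h.apply_orbit_true_succ s n),
      e.inner_vec]
    by_cases h1 : s = t <;> by_cases h2 : n = m <;> simp [h1, h2]

/-- T and T* move orbit vectors to neighbours or to 0, so the complement of the orbits reduces T. It
is orthogonal to both defect spaces, and `eq_bot_of_isSimple` applies. -/
theorem eq_zero_of_orthogonal_orbit {x : H} (hx : ∀ i, inner ℂ (e.orbit T i) x = 0) : x = 0 := by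
  set K := (Submodule.span ℂ (Set.range (e.orbit T)))ᗮ with hK
  have hmem : ∀ y, y ∈ K ↔ ∀ i, inner ℂ (e.orbit T i) y = 0 := by
    intro y
    constructor
    · intro hy i
      exact (Submodule.mem_orthogonal _ _).1 hy _ (Submodule.subset_span ⟨i, rfl⟩)
    · intro hy
      rw [hK, Submodule.mem_orthogonal]
      intro u hu
      induction hu using Submodule.span_induction with
      | mem u hu => obtain ⟨i, rfl⟩ := hu; exact hy i
      | zero => exact inner_zero_left _
      | add u v _ _ hu hv => rw [inner_add_left, hu, hv, add_zero]
      | smul c u _ hu => rw [inner_smul_left, hu, mul_zero]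
  have hbot : K = ⊥ := by
    refine h.cayley.eq_bot_of_isSimple h.symm h.closed h.simple K ?_ ?_ ?_ ?_
    · intro x hx n hn
      obtain ⟨c, d, rfl⟩ := e.exists_of_mem_defect_I h.symm h.comm hn
      rw [inner_add_left, inner_smul_left, inner_smul_left, ← e.orbit_zero T, ← e.orbit_zero T,
        (hmem x).1 hx, (hmem x).1 hx]
      simp
    · intro x hx n hn
      obtain ⟨c, d, rfl⟩ := e.exists_of_mem_defect_neg_I h.symm h.comm hn
      rw [inner_add_left, inner_smul_left, inner_smul_left, ← e.orbit_zero T, ← e.orbit_zero T,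
        (hmem x).1 hx, (hmem x).1 hx]
      simp
    · intro x hx
      rw [hmem] at hx ⊢
      rintro ⟨k, s, n⟩
      rw [← ContinuousLinearMap.adjoint_inner_left]
      cases k
      · cases n with
        | zero => rw [h.adjoint_orbit_false_zero, inner_zero_left]
        | succ n => rw [h.adjoint_orbit_false_succ, hx]
      · rw [e.adjoint_orbit_true, hx]
    · intro x hx
      rw [hmem] at hx ⊢
      rintro ⟨k, s, n⟩
      rw [ContinuousLinearMap.adjoint_inner_right]
      cases k
      · rw [e.apply_orbit_false, hx]
      · cases n with
        | zero => rw [h.apply_orbit_true_zero, inner_zero_left]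
        | succ n => rw [h.apply_orbit_true_succ, hx]
  have := (hmem x).2 hx
  rwa [hbot, Submodule.mem_bot] at this

theorem norm_ne_zero : (‖e.epp‖ : ℂ) ≠ 0 := by
  have : ‖(e.epp : H)‖ ≠ 0 := norm_ne_zero_iff.2 h.epp_ne_zero
  exact_mod_cast this

/-- The freedom in `c` and `σ` provides a twisted copy of the orbit basis, so that the basis change
defines the interchange operator of `exists_swap`. -/
theorem exists_hilbertBasis (c : Bool → Bool → ℂ) (σ : Bool → Bool) (hσ : Function.Involutive σ)
    (hc : ∀ k s, ‖c k s‖ = 1) : ∃ b : HilbertBasis (Bool × Bool × ℕ) ℂ H,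
      ∀ k s n, b (k, s, n) = ((‖e.epp‖ : ℂ)⁻¹ * c k s) • e.orbit T (k, σ s, n) := by
  set f : Bool × Bool × ℕ → H :=
    fun i => ((‖e.epp‖ : ℂ)⁻¹ * c i.1 i.2.1) • e.orbit T (i.1, σ i.2.1, i.2.2) with hf
  have hcc : ∀ k s, (starRingEnd ℂ) (c k s) * c k s = 1 := by
    intro k s
    rw [Complex.conj_mul', hc]
    simp
  have hon : Orthonormal ℂ f := by
    rw [orthonormal_iff_ite]
    rintro ⟨k, s, n⟩ ⟨l, t, m⟩
    simp only [hf]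
    rw [inner_smul_left, inner_smul_right, h.inner_orbit]
    have hinj : (k, σ s, n) = (l, σ t, m) ↔ (k, s, n) = (l, t, m) := by
      simp only [Prod.mk.injEq, hσ.injective.eq_iff]
    simp only [hinj]
    split_ifs with h1
    · obtain ⟨rfl, rfl, rfl⟩ : k = l ∧ s = t ∧ n = m := by simpa using h1
      rw [map_mul, map_inv₀, Complex.conj_ofReal]
      have h2 := h.norm_ne_zero
      field_simp
      rw [mul_comm, mul_comm, hcc]
    · simp
  refine ⟨HilbertBasis.mkOfOrthogonalEqBot hon ?_, fun k s n => ?_⟩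
  · rw [Submodule.eq_bot_iff]
    intro x hx
    refine h.eq_zero_of_orthogonal_orbit ?_
    rintro ⟨k, s, n⟩
    have h1 := (Submodule.mem_orthogonal _ _).1 hx (f (k, σ s, n)) (Submodule.subset_span ⟨_, rfl⟩)
    simp only [hf] at h1
    rw [hσ, inner_smul_left] at h1
    refine (mul_eq_zero.1 h1).resolve_left ?_
    refine (map_ne_zero _).2 ?_
    refine mul_ne_zero (inv_ne_zero h.norm_ne_zero) fun h2 => ?_
    have := hc k (σ s)
    rw [h2, norm_zero] at this
    exact zero_ne_one this
  · rw [HilbertBasis.coe_mkOfOrthogonalEqBot]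

/-- Bounded operators agreeing on the orbit are equal. -/
theorem ext_orbit {A B : H →L[ℂ] H} (hAB : ∀ k s n, A (e.orbit T (k, s, n)) = B (e.orbit T (k, s, n)))
    (x : H) : A x = B x := by
  obtain ⟨b, hb⟩ := h.exists_hilbertBasis (fun _ _ => 1) id (fun _ => rfl) (fun _ _ => norm_one)
  have hd : Dense (Submodule.span ℂ (Set.range b) : Set H) := by
    rw [Submodule.dense_iff_topologicalClosure_eq_top]
    exact b.dense_span
  have : A = B := by
    refine ContinuousLinearMap.ext_on hd ?_
    rintro _ ⟨⟨k, s, n⟩, rfl⟩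
    rw [hb, map_smul, map_smul]
    exact congrArg _ (hAB k s n)
  rw [this]

theorem op_apply (x : H) : J.op (T x) = T (J.op x) :=
  h.cayley.commute_of_map_mem h.symm h.closed (fun _ _ => h.comm.mem_graph)
    (fun _ hn => J.map_defect h.symm h.comm hn) x

theorem op_adjoint (x : H) :
    J.op (ContinuousLinearMap.adjoint T x) = ContinuousLinearMap.adjoint T (J.op x) := by
  refine ext_inner_right ℂ fun y => ?_
  rw [J.inner_op_left, ContinuousLinearMap.adjoint_inner_left, ← h.op_apply, ← J.inner_op_left,
    ContinuousLinearMap.adjoint_inner_left]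

theorem op_orbit (k s : Bool) (n : ℕ) :
    J.op (e.orbit T (k, s, n)) = signOf s • e.orbit T (k, s, n) := by
  cases k
  · induction n with
    | zero => exact e.op_vec false s
    | succ n ih => rw [← e.apply_orbit_false, h.op_apply, ih, map_smul]
  · induction n with
    | zero => exact e.op_vec true s
    | succ n ih => rw [← e.adjoint_orbit_true, h.op_adjoint, ih, map_smul]

/-- There are unitary self-adjoint operators commuting with `S`, anticommuting with `J` and
interchanging the defect vectors of the two parts of `S` up to arbitrary phases. -/
theorem exists_swap (c : Bool → Bool → ℂ) (hc : ∀ k s, ‖c k s‖ = 1)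
    (hcc : ∀ k s, c k s * c k (!s) = 1) : ∃ R : H →L[ℂ] H,
      (∀ x, ‖R x‖ = ‖x‖) ∧ (∀ x y, inner ℂ (R x) y = inner ℂ x (R y)) ∧ (∀ x, R (R x) = x) ∧
      (∀ x, R (J.op x) = -J.op (R x)) ∧ (∀ u v, (u, v) ∈ S.graph → (R u, R v) ∈ S.graph) ∧
      ∀ k s, R (e.vec k s) = c k s • e.vec k (!s) := by
  obtain ⟨b, hb⟩ := h.exists_hilbertBasis (fun _ _ => 1) id (fun _ => rfl) (fun _ _ => norm_one)
  obtain ⟨b', hb'⟩ := h.exists_hilbertBasis c (fun s => !s) Bool.not_not hc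
  let U : H ≃ₗᵢ[ℂ] H := b.repr.trans b'.repr.symm
  have hU : ∀ i, U (b i) = b' i := by
    intro i
    change b'.repr.symm (b.repr (b i)) = b' i
    rw [HilbertBasis.repr_self, HilbertBasis.repr_symm_single]
  let R : H →L[ℂ] H := (U.toContinuousLinearEquiv : H →L[ℂ] H)
  have hRU : ∀ x, R x = U x := fun _ => rfl
  have hR : ∀ k s n, R (e.orbit T (k, s, n)) = c k s • e.orbit T (k, !s, n) := by
    intro k s n
    have h1 := hU (k, s, n)
    rw [hb, hb', ← hRU, map_smul, mul_one, mul_smul] at h1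
    exact smul_right_injective H (inv_ne_zero h.norm_ne_zero) h1
  have hRR : ∀ x, R (R x) = x := by
    refine h.ext_orbit (A := R.comp R) (B := ContinuousLinearMap.id ℂ H) fun k s n => ?_
    change R (R _) = _
    rw [hR, map_smul, hR, Bool.not_not, smul_smul, hcc, one_smul]
    rfl
  -- The phases do not depend on the position along the orbit, so R commutes with the shifts.
  have hRT : ∀ x, R (T x) = T (R x) := by
    refine h.ext_orbit (A := R.comp T) (B := T.comp R) fun k s n => ?_
    change R (T _) = T (R _)
    cases k
    · rw [e.apply_orbit_false, hR, hR, map_smul, e.apply_orbit_false]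
    · cases n with
      | zero => rw [h.apply_orbit_true_zero, hR, map_smul, h.apply_orbit_true_zero, map_zero,
          smul_zero]
      | succ n => rw [h.apply_orbit_true_succ, hR, hR, map_smul, h.apply_orbit_true_succ]
  have hinner : ∀ x y, inner ℂ (R x) y = inner ℂ x (R y) := by
    intro x y
    -- A unitary involution is self-adjoint: (Rx, y) = (Rx, RRy) = (x, Ry).
    conv_lhs => rw [← hRR y]
    exact U.inner_map_map x (R y)
  have hRT' : ∀ x, R (ContinuousLinearMap.adjoint T x) = ContinuousLinearMap.adjoint T (R x) := by
    intro x
    refine ext_inner_right ℂ fun y => ?_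
    rw [hinner, ContinuousLinearMap.adjoint_inner_left, ← hRT, ← hinner,
      ContinuousLinearMap.adjoint_inner_left]
  refine ⟨R, fun x => U.norm_map x, hinner, hRR, ?_,
    fun u v => h.cayley.map_mem_graph h.symm h.closed hRT hRT', fun k s => hR k s 0⟩
  refine h.ext_orbit (A := R.comp J.op) (B := -(J.op.comp R)) fun k s n => ?_
  change R (J.op _) = -J.op (R _)
  rw [h.op_orbit, map_smul, hR, map_smul, h.op_orbit, smul_smul, smul_smul, ← neg_smul]
  congr 1
  cases s <;> simp [signOf]

end IsShiftModel

end KreinExt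

/-! ### Elements of 𝔘, and emptiness of Υ_𝔘. -/

namespace KreinExt

variable {H : Type*} [NormedAddCommGroup H] [InnerProductSpace ℂ H] [CompleteSpace H]

theorem mem_graph_kreinAdjoint {J : FundamentalSymmetry H} {A : H →ₗ.[ℂ] H}
    (hA : Dense (A.domain : Set H)) {x y : H} :
    (x, y) ∈ (kreinAdjoint J A).graph ↔
      ∀ p q, (p, q) ∈ A.graph → inner ℂ q (J.op x) = inner ℂ p (J.op y) := by
  rw [← mem_graph_adjoint hA]
  simp only [kreinAdjoint, mem_graph_opMul, mem_graph_everywhere, ContinuousLinearMap.coe_coe]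
  constructor
  · rintro ⟨z, ⟨w, rfl, hw⟩, rfl⟩
    rwa [J.op_op]
  · intro h
    exact ⟨J.op y, ⟨J.op x, rfl, h⟩, J.op_op y⟩

theorem op_mem_CSymmetries {J : FundamentalSymmetry H} {S : H →ₗ.[ℂ] H}
    (hSJ : Commutes S J.op) : J.op ∈ CSymmetries J S := by
  refine ⟨J.sq_eq_one, ?_, hSJ⟩
  rw [J.sq_eq_one]
  refine ⟨.one _, fun x hx => ?_⟩
  rw [one_apply_eq_self, inner_self_eq_norm_sq_to_K]
  have : 0 < ‖x‖ ^ 2 := pow_pos (norm_pos_iff.2 hx) 2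
  simpa only [Complex.coe_algebraMap, ← Complex.ofReal_pow, Complex.ofReal_re] using this

theorem UpsilonJ_subset_SigmaJst {J : FundamentalSymmetry H} {S : H →ₗ.[ℂ] H}
    (hSJ : Commutes S J.op) : UpsilonJ J S ⊆ SigmaJst J S :=
  fun _ hA => ⟨hA.1, J.op, op_mem_CSymmetries hSJ, hA.2⟩

/-- The operators `J (a + b R)`, with `R` a unitary involution anticommuting with `J` and
`a² - b² = 1`, belong to `𝔘`. -/
theorem op_mul_mem_CSymmetries {J : FundamentalSymmetry H} {S : H →ₗ.[ℂ] H}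
    (hSJ : Commutes S J.op) {R : H →L[ℂ] H} (hnorm : ∀ x, ‖R x‖ = ‖x‖)
    (hinner : ∀ x y, inner ℂ (R x) y = inner ℂ x (R y)) (hRR : ∀ x, R (R x) = x)
    (hRJ : ∀ x, R (J.op x) = -J.op (R x))
    (hRS : ∀ u v, (u, v) ∈ S.graph → (R u, R v) ∈ S.graph) {a b : ℝ} (ha : 0 < a)
    (hab : a ^ 2 - b ^ 2 = 1) : J.op * ((a : ℂ) • 1 + (b : ℂ) • R) ∈ CSymmetries J S := by
  have hab' : (a : ℂ) ^ 2 - (b : ℂ) ^ 2 = 1 := by exact_mod_cast hab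
  have hJC : J.op * (J.op * ((a : ℂ) • 1 + (b : ℂ) • R)) = (a : ℂ) • 1 + (b : ℂ) • R := by
    rw [← mul_assoc, J.sq_eq_one, one_mul]
  -- J(a + bR)J = a - bR, hence C² = (a - bR)(a + bR) = a² - b² = 1. Positivity holds because JC = a
  -- + bR ≥ a - |b| > 0.
  have hCC : ∀ x, (J.op * ((a : ℂ) • 1 + (b : ℂ) • R))
      ((J.op * ((a : ℂ) • 1 + (b : ℂ) • R)) x) = x := by
    intro x
    simp only [mul_apply_eq_comp, add_apply, smul_apply, one_apply_eq_self, map_add, map_smul,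
      J.op_op, hRJ, hRR, map_neg]
    have : x = ((a : ℂ) ^ 2 - (b : ℂ) ^ 2) • x := by rw [hab', one_smul]
    conv_rhs => rw [this]
    module
  refine ⟨ContinuousLinearMap.ext hCC, ⟨?_, fun x hx => ?_⟩, commutes_of_involutive hCC ?_⟩
  · rw [hJC, ContinuousLinearMap.isSelfAdjoint_iff_isSymmetric]
    intro x y
    simp only [ContinuousLinearMap.coe_coe, add_apply, smul_apply, one_apply_eq_self,
      inner_add_left, inner_add_right, inner_smul_left, inner_smul_right, hinner,
      Complex.conj_ofReal]
  · rw [hJC]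
    have h1 : (inner ℂ (((a : ℂ) • (1 : H →L[ℂ] H) + (b : ℂ) • R) x) x).re =
        a * ‖x‖ ^ 2 + b * (inner ℂ (R x) x).re := by
      simp only [add_apply, smul_apply, one_apply_eq_self, inner_add_left, inner_smul_left,
        Complex.conj_ofReal, inner_self_eq_norm_sq_to_K, Complex.coe_algebraMap,
        ← Complex.ofReal_pow, Complex.add_re, Complex.re_ofReal_mul, Complex.ofReal_re]
    have h2 : |(inner ℂ (R x) x).re| ≤ ‖x‖ ^ 2 := by
      refine (Complex.abs_re_le_norm _).trans ((norm_inner_le_norm _ _).trans ?_)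
      rw [hnorm, sq]
    have h3 : |b| < a := abs_lt_of_sq_lt_sq (by linarith) ha.le
    have h4 : 0 < ‖x‖ ^ 2 := pow_pos (norm_pos_iff.2 hx) 2
    have h5 : |b * (inner ℂ (R x) x).re| ≤ |b| * ‖x‖ ^ 2 := by
      rw [abs_mul]
      exact mul_le_mul_of_nonneg_left h2 (abs_nonneg _)
    rw [h1]
    have := neg_le_of_abs_le h5
    nlinarith
  · intro x y hxy
    exact hSJ.mem_graph (graph_add (graph_smul (a : ℂ) hxy) (graph_smul (b : ℂ) (hRS _ _ hxy)))

namespace IsShiftModel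

variable {J : FundamentalSymmetry H} {S : H →ₗ.[ℂ] H} {T : H →L[ℂ] H} {e : DefectBasis J S}
  (h : IsShiftModel J S T e)

include h

/-- No `J`-self-adjoint extension commutes with all of `𝔘`. -/
theorem UpsilonU_eq_empty : UpsilonU J S = ∅ := by
  rw [Set.eq_empty_iff_forall_notMem]
  rintro A ⟨⟨hSA, hAd, hAJ⟩, hcomm⟩
  have hSA' : ∀ {u v}, (u, v) ∈ S.graph → (u, v) ∈ A.graph :=
    fun huv => LinearPMap.le_graph_of_le hSA huv
  have hAC := hcomm J.op (op_mem_CSymmetries h.comm)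
  have hmemA : ∀ x y, (x, y) ∈ A.graph ↔
      ∀ p q, (p, q) ∈ A.graph → inner ℂ q (J.op x) = inner ℂ p (J.op y) := by
    intro x y
    rw [← mem_graph_kreinAdjoint hAd, hAJ]
  -- Being J-self-adjoint and commuting with J, A is self-adjoint, so it has no nonreal eigenvalues.
  have hadj : ∀ x y, (x, y) ∈ A.graph ↔
      ∀ p q, (p, q) ∈ A.graph → inner ℂ q x = inner ℂ p y := by
    intro x y
    constructor
    · intro hxy p q hpq
      have := (hmemA _ _).1 (hAC.mem_graph hxy) p q hpq
      rwa [J.op_op, J.op_op] at this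
    · intro hxy
      rw [hmemA]
      intro p q hpq
      rw [← J.inner_op_left, ← J.inner_op_left]
      exact hxy _ _ (hAC.mem_graph hpq)
  have hzero : ∀ n : H, ∀ μ : ℂ, (starRingEnd ℂ) μ ≠ μ → (n, μ • n) ∈ A.graph → n = 0 := by
    intro n μ hμ hn
    have := (hadj _ _).1 hn _ _ hn
    rw [inner_smul_left, inner_smul_right, ← sub_eq_zero, ← sub_mul] at this
    exact inner_self_eq_zero.1 ((mul_eq_zero.1 this).resolve_left (sub_ne_zero.2 hμ))
  have hI : (starRingEnd ℂ) Complex.I ≠ Complex.I := by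
    rw [Complex.conj_I]
    norm_num [Complex.ext_iff]
  have hI' : (starRingEnd ℂ) (-Complex.I) ≠ -Complex.I := by
    rw [map_neg, Complex.conj_I]
    norm_num [Complex.ext_iff]
  have hswap : ∀ c : Bool → ℂ, (∀ k, c k = 1 ∨ c k = -1) → ∃ R : H →L[ℂ] H,
      (∀ {x y}, (x, y) ∈ A.graph → (R x, R y) ∈ A.graph) ∧
      (∀ u v, (u, v) ∈ S.graph → (R u, R v) ∈ S.graph) ∧
      ∀ k s, R (e.vec k s) = c k • e.vec k (!s) := by
    intro c hc
    obtain ⟨R, hn, hin, hRR, hRJ, hRS, hRe⟩ := h.exists_swap (fun k _ => c k)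
      (fun k _ => by rcases hc k with h1 | h1 <;> simp [h1])
      (fun k _ => by rcases hc k with h1 | h1 <;> simp [h1])
    have hC := hcomm _ (op_mul_mem_CSymmetries h.comm hn hin hRR hRJ hRS
      -- Any a > 0, b ≠ 0 with a² - b² = 1 would do; then R = (JC - a)/b also preserves A.
      (a := 5 / 4) (b := 3 / 4) (by norm_num) (by norm_num))
    refine ⟨R, fun {x y} hxy => ?_, hRS, hRe⟩
    have h1 := hAC.mem_graph (hC.mem_graph hxy)
    have h2 : ∀ z, (4 / 3 : ℂ) • (J.op ((J.op * (((5 / 4 : ℝ) : ℂ) • (1 : H →L[ℂ] H) +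
        ((3 / 4 : ℝ) : ℂ) • R)) z) - (5 / 4 : ℂ) • z) = R z := by
      intro z
      simp only [mul_apply_eq_comp, J.op_op, add_apply, smul_apply, one_apply_eq_self]
      push_cast
      module
    have h3 := graph_smul (4 / 3) (graph_sub h1 (graph_smul (5 / 4) hxy))
    rwa [h2, h2] at h3
  obtain ⟨R₁, hA₁, hS₁, he₁⟩ := hswap (fun _ => 1) (fun _ => Or.inl rfl)
  -- The two involutions agree on N_i and are opposite on N_{-i}, so R₁R₂ separates the two
  -- components of a vector in D(A).
  obtain ⟨R₂, hA₂, hS₂, he₂⟩ := hswap (fun k => bif k then 1 else -1)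
    (fun k => by cases k <;> simp)
  have hASg : ∀ x y, (x, y) ∈ A.graph → (x, y) ∈ S.graph := by
    intro x y hxy
    have hxS : (x, y) ∈ S.adjoint.graph := by
      rw [h.symm.mem_adjoint_iff]
      exact fun u v huv => (hadj _ _).1 hxy u v (hSA' huv)
    obtain ⟨u, v, n, m, huv, hn, hm, rfl, rfl⟩ := h.symm.exists_vonNeumann h.closed hxS
    have h1 := graph_sub hxy (hSA' huv)
    have h2 := hA₁ (hA₂ h1)
    have hRn : R₁ (R₂ n) = n := by
      obtain ⟨c, d, rfl⟩ := e.exists_of_mem_defect_I h.symm h.comm hn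
      simp [he₁, he₂]
    have hRm : R₁ (R₂ m) = -m := by
      obtain ⟨c, d, rfl⟩ := e.exists_of_mem_defect_neg_I h.symm h.comm hm
      simp [he₁, he₂]
      abel
    have e1 : u + n + m - u = n + m := by abel
    have e2 : v + Complex.I • n - Complex.I • m - v = Complex.I • n - Complex.I • m := by abel
    rw [e1, e2] at h1 h2
    simp only [map_add, map_sub, map_smul, hRn, hRm] at h2
    have hn0 : n = 0 := by
      refine hzero n _ hI ?_
      convert graph_smul (1 / 2) (graph_add h1 h2) using 2 <;> module
    have hm0 : m = 0 := by
      refine hzero m _ hI' ?_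
      convert graph_smul (1 / 2) (graph_sub h1 h2) using 2 <;> module
    rw [hn0, hm0]
    simpa using huv
  have h1 : (e.vec true true, Complex.I • e.vec true true) ∈ A.graph := by
    rw [hadj]
    intro p q hpq
    exact h.symm.mem_adjoint_iff.1 (mem_defectSpace.1 (h.vec_true_mem true)) p q (hASg p q hpq)
  exact h.epp_ne_zero (hzero _ _ hI h1)

end IsShiftModel

end KreinExt

/-! ### The extensions A_U in defect coordinates. -/

namespace KreinExt

variable {H : Type*} [NormedAddCommGroup H] [InnerProductSpace ℂ H] [CompleteSpace H]

namespace DefectBasis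

variable {J : FundamentalSymmetry H} {S : H →ₗ.[ℂ] H} (e : DefectBasis J S)

/-- The vector of `N_i + N_{-i}` with coordinates `a, b, c, d` with respect to
`e_{++}, e_{+-}, e_{-+}, e_{--}`. -/
def comb (a b c d : ℂ) : H :=
  (a • e.vec true true + b • e.vec true false) + (c • e.vec false true + d • e.vec false false)

/-- The value of `S*` at `comb a b c d`. -/
def adjComb (a b c d : ℂ) : H :=
  Complex.I • (a • e.vec true true + b • e.vec true false) -
    Complex.I • (c • e.vec false true + d • e.vec false false)

theorem mem_neutralSpace {U : Matrix (Fin 2) (Fin 2) ℂ} {x : H} :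
    x ∈ neutralSpace e U ↔
      ∃ p q : ℂ, x = e.comb p (p * U 0 0 + q * U 1 0) (p * U 0 1 + q * U 1 1) q := by
  rw [neutralSpace, Submodule.mem_span_pair]
  refine exists_congr fun p => exists_congr fun q => ?_
  rw [eq_comm]
  have : p • ((e.epp : H) + U 0 0 • (e.epm : H) + U 0 1 • (e.emp : H)) +
      q • ((e.emm : H) + U 1 0 • (e.epm : H) + U 1 1 • (e.emp : H)) =
      e.comb p (p * U 0 0 + q * U 1 0) (p * U 0 1 + q * U 1 1) q := by
    simp only [comb, vec]
    module
  rw [this]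

theorem op_comb (a b c d : ℂ) : J.op (e.comb a b c d) = e.comb a (-b) c (-d) := by
  simp only [comb, map_add, map_smul, e.op_vec, signOf, cond_true, cond_false]
  module

theorem op_adjComb (a b c d : ℂ) : J.op (e.adjComb a b c d) = e.adjComb a (-b) c (-d) := by
  simp only [adjComb, map_add, map_sub, map_smul, e.op_vec, signOf, cond_true, cond_false]
  module

/-- The boundary form is positive on N_i and negative on N_{-i} up to a common factor; equal norms
of the four vectors make that factor uniform. -/
theorem inner_adjComb_sub (a b c d a' b' c' d' : ℂ) :
    inner ℂ (e.adjComb a b c d) (e.comb a' b' c' d') -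
      inner ℂ (e.comb a b c d) (e.adjComb a' b' c' d') =
    -(2 * Complex.I * (‖e.epp‖ : ℂ) ^ 2) *
      ((starRingEnd ℂ) a * a' + (starRingEnd ℂ) b * b' -
        (starRingEnd ℂ) c * c' - (starRingEnd ℂ) d * d') := by
  simp only [comb, adjComb, inner_add_left, inner_add_right, inner_sub_left, inner_sub_right,
    inner_smul_left, inner_smul_right, e.inner_vec true, e.inner_vec false, Complex.conj_I]
  simp only [reduceCtorEq, if_true, if_false]
  ring

end DefectBasis

section Extension

variable {J : FundamentalSymmetry H} {S : H →ₗ.[ℂ] H} {e : DefectBasis J S}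

theorem mem_graph_extOfMatrix {U : Matrix (Fin 2) (Fin 2) ℂ} {x y : H} :
    (x, y) ∈ (extOfMatrix e U).graph ↔
      x ∈ S.domain ⊔ neutralSpace e U ∧ (x, y) ∈ S.adjoint.graph :=
  mem_graph_domRestrict

theorem mem_sup_neutralSpace {U : Matrix (Fin 2) (Fin 2) ℂ} {x : H} :
    x ∈ S.domain ⊔ neutralSpace e U ↔ ∃ u v p q, (u, v) ∈ S.graph ∧
      x = u + e.comb p (p * U 0 0 + q * U 1 0) (p * U 0 1 + q * U 1 1) q := by
  rw [Submodule.mem_sup]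
  constructor
  · rintro ⟨u, hu, m, hm, rfl⟩
    obtain ⟨p, q, rfl⟩ := e.mem_neutralSpace.1 hm
    exact ⟨u, _, p, q, mem_graph_iff_exists.2 ⟨hu, rfl⟩, rfl⟩
  · rintro ⟨u, v, p, q, huv, rfl⟩
    exact ⟨u, (mem_graph_iff_exists.1 huv).1, _, e.mem_neutralSpace.2 ⟨p, q, rfl⟩, rfl⟩

/-- An involution preserving `S`, `S*` and `D(S) + M_U` commutes with `A_U`. -/
theorem commutes_extOfMatrix {U : Matrix (Fin 2) (Fin 2) ℂ} {C : H →L[ℂ] H}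
    (hCC : ∀ x, C (C x) = x) (hCS : ∀ u v, (u, v) ∈ S.graph → (C u, C v) ∈ S.graph)
    (hCS' : ∀ u v, (u, v) ∈ S.adjoint.graph → (C u, C v) ∈ S.adjoint.graph)
    (h1 : ∃ p q, C (e.comb 1 (U 0 0) (U 0 1) 0) =
      e.comb p (p * U 0 0 + q * U 1 0) (p * U 0 1 + q * U 1 1) q)
    (h2 : ∃ p q, C (e.comb 0 (U 1 0) (U 1 1) 1) =
      e.comb p (p * U 0 0 + q * U 1 0) (p * U 0 1 + q * U 1 1) q) :
    Commutes (extOfMatrix e U) C := by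
  refine commutes_of_involutive hCC fun x y hxy => ?_
  rw [mem_graph_extOfMatrix] at hxy ⊢
  obtain ⟨hx, hxy⟩ := hxy
  refine ⟨?_, hCS' _ _ hxy⟩
  obtain ⟨u, v, p, q, huv, rfl⟩ := mem_sup_neutralSpace.1 hx
  have e1 : e.comb p (p * U 0 0 + q * U 1 0) (p * U 0 1 + q * U 1 1) q =
      p • e.comb 1 (U 0 0) (U 0 1) 0 + q • e.comb 0 (U 1 0) (U 1 1) 1 := by
    simp only [DefectBasis.comb]
    module
  rw [e1, map_add, map_add, map_smul, map_smul]
  refine Submodule.mem_sup.2 ⟨_, (mem_graph_iff_exists.1 (hCS _ _ huv)).1, _, ?_, rfl⟩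
  exact Submodule.add_mem _ (Submodule.smul_mem _ _ (e.mem_neutralSpace.2 h1))
    (Submodule.smul_mem _ _ (e.mem_neutralSpace.2 h2))

end Extension

namespace IsShiftModel

variable {J : FundamentalSymmetry H} {S : H →ₗ.[ℂ] H} {T : H →L[ℂ] H} {e : DefectBasis J S}
  (h : IsShiftModel J S T e)

include h

theorem comb_mem_adjoint (a b c d : ℂ) :
    (e.comb a b c d, e.adjComb a b c d) ∈ S.adjoint.graph := by
  have hp := Submodule.add_mem _ (Submodule.smul_mem _ a (h.vec_true_mem true))
    (Submodule.smul_mem _ b (h.vec_true_mem false))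
  have hm := Submodule.add_mem _ (Submodule.smul_mem _ c (h.vec_false_mem true))
    (Submodule.smul_mem _ d (h.vec_false_mem false))
  have := graph_add (mem_defectSpace.1 hp) (mem_defectSpace.1 hm)
  rwa [neg_smul, ← sub_eq_add_neg] at this

theorem exists_comb {x y : H} (hxy : (x, y) ∈ S.adjoint.graph) :
    ∃ u v a b c d, (u, v) ∈ S.graph ∧ x = u + e.comb a b c d ∧ y = v + e.adjComb a b c d := by
  obtain ⟨u, v, n, m, huv, hn, hm, rfl, rfl⟩ := h.symm.exists_vonNeumann h.closed hxy
  obtain ⟨a, b, rfl⟩ := e.exists_of_mem_defect_I h.symm h.comm hn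
  obtain ⟨c, d, rfl⟩ := e.exists_of_mem_defect_neg_I h.symm h.comm hm
  exact ⟨u, v, a, b, c, d, huv, add_assoc _ _ _, add_sub_assoc _ _ _⟩

theorem coeff_unique {k : Bool} {a b a' b' : ℂ}
    (heq : a • e.vec k true + b • e.vec k false = a' • e.vec k true + b' • e.vec k false) :
    a = a' ∧ b = b' := by
  have hN := pow_ne_zero 2 h.norm_ne_zero
  have h1 := congrArg (inner ℂ (e.vec k true)) heq
  have h2 := congrArg (inner ℂ (e.vec k false)) heq
  simp only [inner_add_right, inner_smul_right, e.inner_vec, reduceCtorEq, if_true, if_false,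
    mul_zero, add_zero, zero_add] at h1 h2
  exact ⟨mul_right_cancel₀ hN h1, mul_right_cancel₀ hN h2⟩

theorem comb_unique {u v u' v' : H} {a b c d a' b' c' d' : ℂ} (huv : (u, v) ∈ S.graph)
    (huv' : (u', v') ∈ S.graph) (heq : u + e.comb a b c d = u' + e.comb a' b' c' d') :
    u = u' ∧ a = a' ∧ b = b' ∧ c = c' ∧ d = d' := by
  have hp : ∀ a b : ℂ, a • e.vec true true + b • e.vec true false ∈ defectSpace S Complex.I :=
    fun a b => Submodule.add_mem _ (Submodule.smul_mem _ a (h.vec_true_mem true))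
      (Submodule.smul_mem _ b (h.vec_true_mem false))
  have hm : ∀ a b : ℂ, a • e.vec false true + b • e.vec false false ∈
      defectSpace S (-Complex.I) :=
    fun a b => Submodule.add_mem _ (Submodule.smul_mem _ a (h.vec_false_mem true))
      (Submodule.smul_mem _ b (h.vec_false_mem false))
  simp only [DefectBasis.comb, ← add_assoc (_ : H) (_ + _) (_ + _)] at heq
  obtain ⟨h1, h2, h3⟩ := h.symm.vonNeumann_unique huv (hp a b) (hm c d) huv' (hp a' b') (hm c' d')
    heq
  obtain ⟨ha, hb⟩ := h.coeff_unique h2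
  obtain ⟨hc, hd⟩ := h.coeff_unique h3
  exact ⟨h1, ha, hb, hc, hd⟩

/-- The boundary form of `S*` in coordinates, twisted by `J`. -/
theorem boundary_form {u v u' v' : H} (huv : (u, v) ∈ S.graph) (huv' : (u', v') ∈ S.graph)
    (a b c d a' b' c' d' : ℂ) :
    inner ℂ (v + e.adjComb a b c d) (J.op (u' + e.comb a' b' c' d')) -
      inner ℂ (u + e.comb a b c d) (J.op (v' + e.adjComb a' b' c' d')) =
    -(2 * Complex.I * (‖e.epp‖ : ℂ) ^ 2) *
      ((starRingEnd ℂ) a * a' - (starRingEnd ℂ) b * b' -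
        (starRingEnd ℂ) c * c' + (starRingEnd ℂ) d * d') := by
  have hJ := h.comm.mem_graph huv'
  have h1 := h.symm.symm huv hJ
  have h2 := h.symm.mem_adjoint_iff.1 (h.comb_mem_adjoint a' (-b') c' (-d')) _ _ huv
  have h3 := h.symm.mem_adjoint_iff.1 (h.comb_mem_adjoint a b c d) _ _ hJ
  have h3' : inner ℂ (e.comb a b c d) (J.op v') = inner ℂ (e.adjComb a b c d) (J.op u') := by
    rw [← inner_conj_symm, h3, inner_conj_symm]
  have h4 := e.inner_adjComb_sub a b c d a' (-b') c' (-d')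
  simp only [map_add, e.op_comb, e.op_adjComb, inner_add_left, inner_add_right]
  rw [h1, h2, h3']
  linear_combination h4

theorem le_extOfMatrix (U : Matrix (Fin 2) (Fin 2) ℂ) : S ≤ extOfMatrix e U := by
  refine LinearPMap.le_of_le_graph ?_
  rintro ⟨u, v⟩ huv
  rw [mem_graph_extOfMatrix]
  exact ⟨Submodule.mem_sup_left (mem_graph_iff_exists.1 huv).1, h.symm.mem_adjoint_of_mem huv⟩

theorem comb_mem_extOfMatrix (U : Matrix (Fin 2) (Fin 2) ℂ) (p q : ℂ) :
    (e.comb p (p * U 0 0 + q * U 1 0) (p * U 0 1 + q * U 1 1) q,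
      e.adjComb p (p * U 0 0 + q * U 1 0) (p * U 0 1 + q * U 1 1) q) ∈
      (extOfMatrix e U).graph := by
  rw [mem_graph_extOfMatrix]
  exact ⟨Submodule.mem_sup_right (e.mem_neutralSpace.2 ⟨p, q, rfl⟩), h.comb_mem_adjoint _ _ _ _⟩

theorem exists_of_mem_extOfMatrix {U : Matrix (Fin 2) (Fin 2) ℂ} {x y : H}
    (hxy : (x, y) ∈ (extOfMatrix e U).graph) : ∃ u v p q, (u, v) ∈ S.graph ∧
      x = u + e.comb p (p * U 0 0 + q * U 1 0) (p * U 0 1 + q * U 1 1) q ∧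
      y = v + e.adjComb p (p * U 0 0 + q * U 1 0) (p * U 0 1 + q * U 1 1) q := by
  obtain ⟨hx, hxy⟩ := mem_graph_extOfMatrix.1 hxy
  obtain ⟨u, v, p, q, huv, rfl⟩ := mem_sup_neutralSpace.1 hx
  refine ⟨u, v, p, q, huv, rfl, ?_⟩
  exact LinearPMap.mem_graph_snd_inj _ hxy
    (graph_add (h.symm.mem_adjoint_of_mem huv) (h.comb_mem_adjoint _ _ _ _)) rfl

/-- `A_U` is a `J`-self-adjoint extension of `S`. -/
theorem extOfMatrix_mem_SigmaJ {U : Matrix (Fin 2) (Fin 2) ℂ}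
    (hU : U ∈ Matrix.unitaryGroup (Fin 2) ℂ) : extOfMatrix e U ∈ SigmaJ J S := by
  have hU2 := Matrix.mem_unitaryGroup_iff'.1 hU
  have hU1 := Matrix.mem_unitaryGroup_iff.1 hU
  have r00 := congrFun (congrFun hU1 0) 0
  have r01 := congrFun (congrFun hU1 0) 1
  have r10 := congrFun (congrFun hU1 1) 0
  have r11 := congrFun (congrFun hU1 1) 1
  have c00 := congrFun (congrFun hU2 0) 0
  have c01 := congrFun (congrFun hU2 0) 1
  have c10 := congrFun (congrFun hU2 1) 0
  have c11 := congrFun (congrFun hU2 1) 1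
  simp only [Matrix.mul_apply, Fin.sum_univ_two, Matrix.star_apply, Matrix.one_apply_eq,
    Matrix.one_apply_ne (zero_ne_one : (0 : Fin 2) ≠ 1),
    Matrix.one_apply_ne (one_ne_zero : (1 : Fin 2) ≠ 0), RCLike.star_def]
    at r00 r01 r10 r11 c00 c01 c10 c11
  have hle := h.le_extOfMatrix U
  have hdense : Dense ((extOfMatrix e U).domain : Set H) := h.symm.dense.mono hle.1
  have hne : -(2 * Complex.I * (‖e.epp‖ : ℂ) ^ 2) ≠ 0 :=
    neg_ne_zero.2 (mul_ne_zero (by simp) (pow_ne_zero 2 h.norm_ne_zero))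
  refine ⟨hle, hdense, graph_ext fun x z => ?_⟩
  rw [mem_graph_kreinAdjoint hdense]
  constructor
  · intro hxz
    have hxS : (x, z) ∈ S.adjoint.graph := by
      have hJ : (J.op x, J.op z) ∈ S.adjoint.graph := by
        rw [h.symm.mem_adjoint_iff]
        exact fun u v huv => hxz u v (LinearPMap.le_graph_of_le hle huv)
      have := J.adjoint_graph_map h.symm h.comm hJ
      rwa [J.op_op, J.op_op] at this
    obtain ⟨u, v, a, b, c, d, huv, rfl, rfl⟩ := h.exists_comb hxS
    -- Orthogonality to M_U in the twisted form. Solving the cases (p, q) = (1, 0), (0, 1) for b and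
    -- c uses the column relations of U; the converse uses the row relations.
    have key : ∀ p q : ℂ, (starRingEnd ℂ) p * a -
        (starRingEnd ℂ) (p * U 0 0 + q * U 1 0) * b -
        (starRingEnd ℂ) (p * U 0 1 + q * U 1 1) * c + (starRingEnd ℂ) q * d = 0 := by
      intro p q
      have h1 := hxz _ _ (h.comb_mem_extOfMatrix U p q)
      have h2 := h.boundary_form S.graph.zero_mem huv p (p * U 0 0 + q * U 1 0)
        (p * U 0 1 + q * U 1 1) q a b c d
      rw [zero_add, zero_add, h1, sub_self] at h2
      exact (mul_eq_zero.1 h2.symm).resolve_left hne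
    have k1 := key 1 0
    have k2 := key 0 1
    simp only [map_one, map_zero, one_mul, zero_mul, add_zero, zero_add] at k1 k2
    rw [mem_graph_extOfMatrix]
    refine ⟨mem_sup_neutralSpace.2 ⟨u, v, a, d, huv, ?_⟩, hxS⟩
    congr 2
    · linear_combination -U 0 0 * k1 - U 1 0 * k2 - b * c00 - c * c10
    · linear_combination -U 0 1 * k1 - U 1 1 * k2 - b * c01 - c * c11
  · intro hxz p q hpq
    obtain ⟨u, v, a, d, huv, rfl, rfl⟩ := h.exists_of_mem_extOfMatrix hxz
    obtain ⟨u', v', a', d', huv', rfl, rfl⟩ := h.exists_of_mem_extOfMatrix hpq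
    rw [← sub_eq_zero, h.boundary_form huv' huv, mul_eq_zero]
    right
    simp only [map_add, map_mul]
    linear_combination (-(starRingEnd ℂ) a' * a) * r00 - (starRingEnd ℂ) d' * d * r11
      - (starRingEnd ℂ) a' * d * r10 - (starRingEnd ℂ) d' * a * r01

/-- `A_U` commutes with `J` exactly when `U` is off-diagonal. -/
theorem extOfMatrix_mem_UpsilonJ_iff {U : Matrix (Fin 2) (Fin 2) ℂ}
    (hU : U ∈ Matrix.unitaryGroup (Fin 2) ℂ) (hU11 : U 0 0 = 0 → U 1 1 = 0) :
    extOfMatrix e U ∈ UpsilonJ J S ↔ U 0 0 = 0 := by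
  constructor
  · rintro ⟨-, hJ⟩
    have h1 := hJ.mem_graph (h.comb_mem_extOfMatrix U 1 0)
    rw [e.op_comb] at h1
    obtain ⟨u, v, p, q, huv, hx, -⟩ := h.exists_of_mem_extOfMatrix h1
    rw [← zero_add (e.comb 1 _ _ _)] at hx
    obtain ⟨-, hp, hb, -, hd⟩ := h.comb_unique S.graph.zero_mem huv hx
    rw [← hp, ← hd] at hb
    -- The e_{++} and e_{--} coordinates of J d₁ are those of d₁, so J d₁ = d₁; the e_{+-}
    -- coordinate then gives -u₁₁ = u₁₁.
    linear_combination (-1 / 2 : ℂ) * hb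
  · intro h0
    have h1 := hU11 h0
    refine ⟨h.extOfMatrix_mem_SigmaJ hU, commutes_extOfMatrix J.op_op
      (fun u v => h.comm.mem_graph) (fun u v => J.adjoint_graph_map h.symm h.comm) ?_ ?_⟩
    · refine ⟨1, 0, ?_⟩
      rw [e.op_comb, h0]
      simp
    · refine ⟨0, -1, ?_⟩
      rw [e.op_comb, h1]
      simp

/-- A diagonal `A_U` commutes with no `C` in `𝔘`. -/
theorem ne_zero_of_mem_SigmaJst {U : Matrix (Fin 2) (Fin 2) ℂ}
    (hrow : (starRingEnd ℂ) (U 0 0) * U 0 0 + (starRingEnd ℂ) (U 0 1) * U 0 1 = 1)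
    (hA : extOfMatrix e U ∈ SigmaJst J S) : U 0 1 ≠ 0 := by
  intro h0
  rw [h0, mul_zero, add_zero] at hrow
  obtain ⟨-, C, ⟨-, ⟨-, hpos⟩, -⟩, hAC⟩ := hA
  have h1 := h.comb_mem_extOfMatrix U 1 0
  simp only [h0, one_mul, zero_mul, mul_zero, add_zero] at h1
  set d := e.comb 1 (U 0 0) 0 0 with hd
  have hId : e.adjComb 1 (U 0 0) 0 0 = Complex.I • d := by
    simp only [hd, DefectBasis.comb, DefectBasis.adjComb]
    module
  rw [hId] at h1
  have h2 := hAC.mem_graph h1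
  obtain ⟨u, v, p, q, huv, hx, -⟩ := h.exists_of_mem_extOfMatrix h2
  have h3 : C d ∈ defectSpace S Complex.I := by
    rw [mem_defectSpace, ← map_smul]
    exact (mem_graph_extOfMatrix.1 h2).2
  obtain ⟨a, b, hab⟩ := e.exists_of_mem_defect_I h.symm h.comm h3
  have hab' : C d = 0 + e.comb a b 0 0 := by
    rw [hab]
    simp [DefectBasis.comb]
  rw [hab'] at hx
  obtain ⟨-, hp, hb, -, hq⟩ := h.comb_unique S.graph.zero_mem huv hx
  -- D(A_U) ∩ N_i is the line through d₁ = e_{++} + u₁₁e_{+-}, and C preserves it. Since |u₁₁| = 1,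
  -- (J d₁, d₁) = 0, which contradicts JC > 0.
  have hCd : C d = p • d := by
    rw [hab', hb, hp, ← hq, hd]
    simp only [DefectBasis.comb]
    module
  have hd0 : d ≠ 0 := by
    intro hd0
    have : (0 : H) + e.comb 1 (U 0 0) 0 0 = 0 + e.comb 0 0 0 0 := by
      rw [← hd, hd0]
      simp [DefectBasis.comb]
    exact one_ne_zero (h.comb_unique S.graph.zero_mem S.graph.zero_mem this).2.1
  have h4 := hpos d hd0
  have h5 : inner ℂ (J.op d) d = 0 := by
    rw [hd, e.op_comb]
    simp only [DefectBasis.comb, inner_add_left, inner_add_right, inner_smul_left,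
      inner_smul_right, e.inner_vec, reduceCtorEq, if_true, if_false, zero_smul, add_zero,
      map_one, map_neg, neg_zero, mul_zero, zero_add]
    linear_combination (-(‖e.epp‖ : ℂ) ^ 2) * hrow
  rw [mul_apply_eq_comp, hCd, map_smul, inner_smul_left, h5, mul_zero] at h4
  simp at h4

end IsShiftModel

end KreinExt

/-! ### Parametrization of unitary 2 × 2 matrices. -/

namespace KreinExt

section UnitaryMatrices

open ComplexConjugate

theorem exists_exp_I_eq {z : ℂ} (hz : ‖z‖ = 1) :
    ∃ θ ∈ Set.Ico 0 (2 * Real.pi), Complex.exp (Complex.I * θ) = z := by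
  obtain ⟨θ, hθ⟩ := (Complex.norm_eq_one_iff z).1 hz
  refine ⟨toIcoMod Real.two_pi_pos 0 θ, ?_, ?_⟩
  · simpa using toIcoMod_mem_Ico Real.two_pi_pos 0 θ
  · rw [← hθ, toIcoMod, Complex.exp_eq_exp_iff_exists_int]
    refine ⟨-toIcoDiv Real.two_pi_pos 0 θ, ?_⟩
    push_cast
    simp
    ring

theorem exists_exp_I_sq_eq {z : ℂ} (hz : ‖z‖ = 1) :
    ∃ θ ∈ Set.Ico 0 (2 * Real.pi), Complex.exp (Complex.I * θ) ^ 2 = z := by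
  obtain ⟨θ, hθ, h⟩ := exists_exp_I_eq hz
  refine ⟨θ / 2, ⟨by linarith [hθ.1], by linarith [hθ.1, hθ.2]⟩, ?_⟩
  rw [← h, ← Complex.exp_nat_mul]
  congr 1
  push_cast
  ring

theorem conj_exp_I (θ : ℝ) :
    conj (Complex.exp (Complex.I * θ)) = Complex.exp (-(Complex.I * θ)) := by
  rw [← Complex.exp_conj, map_mul, Complex.conj_I, Complex.conj_ofReal, neg_mul]

theorem conj_mul_self_of_norm_eq_one {z : ℂ} (hz : ‖z‖ = 1) : conj z * z = 1 := by
  rw [Complex.conj_mul', hz]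
  simp

theorem norm_exp_I (θ : ℝ) : ‖Complex.exp (Complex.I * θ)‖ = 1 := by
  rw [mul_comm, Complex.norm_exp_ofReal_mul_I]

/-- The second row of a unitary `2 × 2` matrix is determined by the first one and the determinant. -/
theorem unitary_fin_two {U : Matrix (Fin 2) (Fin 2) ℂ} (hU : U ∈ Matrix.unitaryGroup (Fin 2) ℂ) :
    ∃ δ : ℂ, ‖δ‖ = 1 ∧ U 1 1 = δ * conj (U 0 0) ∧ U 1 0 = -(δ * conj (U 0 1)) ∧
      conj (U 0 0) * U 0 0 + conj (U 0 1) * U 0 1 = 1 := by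
  have hU1 := Matrix.mem_unitaryGroup_iff.1 hU
  have r00 := congrFun (congrFun hU1 0) 0
  have r10 := congrFun (congrFun hU1 1) 0
  simp only [Matrix.mul_apply, Fin.sum_univ_two, Matrix.star_apply, Matrix.one_apply_eq,
    Matrix.one_apply_ne (one_ne_zero : (1 : Fin 2) ≠ 0), RCLike.star_def] at r00 r10
  refine ⟨U.det, ?_, ?_, ?_, ?_⟩
  · have h1 := (Matrix.det_of_mem_unitary hU).1
    have h2 : ((‖U.det‖ : ℂ)) ^ 2 = 1 := by
      rw [← Complex.conj_mul']
      exact h1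
    have h3 : ‖U.det‖ ^ 2 = 1 := by exact_mod_cast h2
    exact (pow_eq_one_iff_of_nonneg (norm_nonneg _) two_ne_zero).1 h3
  · rw [Matrix.det_fin_two]
    linear_combination -U 1 1 * r00 + U 0 1 * r10
  · rw [Matrix.det_fin_two]
    linear_combination -U 1 0 * r00 + U 0 0 * r10
  · linear_combination r00

theorem unitary_offDiag_iff {U : Matrix (Fin 2) (Fin 2) ℂ}
    (hU : U ∈ Matrix.unitaryGroup (Fin 2) ℂ) :
    U 0 0 = 0 ↔ ∃ φ ∈ Set.Ico 0 (2 * Real.pi), ∃ ξ ∈ Set.Ico 0 (2 * Real.pi),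
      U = Complex.exp (Complex.I * φ) •
        !![0, Complex.exp (Complex.I * ξ); -Complex.exp (-(Complex.I * ξ)), 0] := by
  constructor
  · intro h0
    obtain ⟨δ, hδ, h11, h10, hrow⟩ := unitary_fin_two hU
    -- The scalar factor must square to δ; after it is divided out, the second row is fixed by the
    -- first.
    obtain ⟨φ, hφ, hφ'⟩ := exists_exp_I_sq_eq hδ
    have hφ1 := conj_mul_self_of_norm_eq_one (norm_exp_I φ)
    have hs : ‖U 0 1‖ = 1 := by
      rw [h0, mul_zero, zero_add, Complex.conj_mul'] at hrow
      have h3 : ‖U 0 1‖ ^ 2 = 1 := by exact_mod_cast hrow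
      exact (pow_eq_one_iff_of_nonneg (norm_nonneg _) two_ne_zero).1 h3
    obtain ⟨ξ, hξ, hξ'⟩ := exists_exp_I_eq
      (z := conj (Complex.exp (Complex.I * φ)) * U 0 1) (by
        rw [norm_mul, Complex.norm_conj, norm_exp_I, hs, one_mul])
    refine ⟨φ, hφ, ξ, hξ, ?_⟩
    rw [← conj_exp_I ξ, hξ']
    ext i j
    fin_cases i <;> fin_cases j
    · simpa using h0
    · simp
      linear_combination -U 0 1 * hφ1
    · simp
      rw [h10, ← hφ']
      ring
    · simp [h11, h0]
  · rintro ⟨φ, -, ξ, -, rfl⟩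
    simp

theorem unitary_full_iff {U : Matrix (Fin 2) (Fin 2) ℂ}
    (hU : U ∈ Matrix.unitaryGroup (Fin 2) ℂ) :
    (U 0 0 ≠ 0 ∧ U 0 1 ≠ 0) ↔ ∃ φ ∈ Set.Ico 0 (2 * Real.pi), ∃ γ ∈ Set.Ico 0 (2 * Real.pi),
      ∃ ξ ∈ Set.Ico 0 (2 * Real.pi), ∃ q r : ℝ, 0 < q ∧ 0 < r ∧ q ^ 2 + r ^ 2 = 1 ∧
      U = Complex.exp (Complex.I * φ) •
        !![q * Complex.exp (Complex.I * γ), r * Complex.exp (Complex.I * ξ);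
          -(r * Complex.exp (-(Complex.I * ξ))), q * Complex.exp (-(Complex.I * γ))] := by
  constructor
  · rintro ⟨h0, h1⟩
    obtain ⟨δ, hδ, h11, h10, hrow⟩ := unitary_fin_two hU
    obtain ⟨φ, hφ, hφ'⟩ := exists_exp_I_sq_eq hδ
    have hφ1 := conj_mul_self_of_norm_eq_one (norm_exp_I φ)
    have hphase : ∀ z : ℂ, z ≠ 0 → ∃ θ ∈ Set.Ico 0 (2 * Real.pi),
        z = Complex.exp (Complex.I * φ) * (‖z‖ * Complex.exp (Complex.I * θ)) := by
      intro z hz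
      have hz' : (‖z‖ : ℂ) ≠ 0 := by exact_mod_cast norm_ne_zero_iff.2 hz
      obtain ⟨θ, hθ, hθ'⟩ := exists_exp_I_eq
        (z := conj (Complex.exp (Complex.I * φ)) * ((‖z‖ : ℂ)⁻¹ * z)) (by
          rw [norm_mul, Complex.norm_conj, norm_exp_I, norm_mul, norm_inv, Complex.norm_real,
            norm_norm, inv_mul_cancel₀ (norm_ne_zero_iff.2 hz), one_mul])
      refine ⟨θ, hθ, ?_⟩
      rw [hθ']
      field_simp
      linear_combination -hφ1
    obtain ⟨γ, hγ, hγ'⟩ := hphase _ h0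
    obtain ⟨ξ, hξ, hξ'⟩ := hphase _ h1
    refine ⟨φ, hφ, γ, hγ, ξ, hξ, ‖U 0 0‖, ‖U 0 1‖, norm_pos_iff.2 h0, norm_pos_iff.2 h1, ?_, ?_⟩
    · rw [Complex.conj_mul', Complex.conj_mul'] at hrow
      exact_mod_cast hrow
    · have h00c := congrArg conj hγ'
      have h01c := congrArg conj hξ'
      simp only [map_mul, Complex.conj_ofReal, conj_exp_I] at h00c h01c
      rw [conj_exp_I] at hφ1
      ext i j
      fin_cases i <;> fin_cases j
      · simpa using hγ'
      · simpa using hξ'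
      · simp only [Fin.mk_one, Fin.zero_eta, Matrix.smul_apply, Matrix.of_apply, Matrix.cons_val_one,
          Matrix.cons_val_zero, Matrix.cons_val_fin_one, smul_eq_mul]
        rw [h10, ← hφ', h01c]
        linear_combination (-Complex.exp (Complex.I * φ) * ‖U 0 1‖ *
          Complex.exp (-(Complex.I * ξ))) * hφ1
      · simp only [Fin.mk_one, Matrix.smul_apply, Matrix.of_apply, Matrix.cons_val_one,
          Matrix.cons_val_fin_one, smul_eq_mul]
        rw [h11, ← hφ', h00c]
        linear_combination (Complex.exp (Complex.I * φ) * ‖U 0 0‖ *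
          Complex.exp (-(Complex.I * γ))) * hφ1
  · rintro ⟨φ, -, γ, -, ξ, -, q, r, hq, hr, -, rfl⟩
    have hq' : (q : ℂ) ≠ 0 := by exact_mod_cast hq.ne'
    have hr' : (r : ℂ) ≠ 0 := by exact_mod_cast hr.ne'
    constructor <;> simp [hq', hr', Complex.exp_ne_zero]

end UnitaryMatrices

/-! ### A stable symmetry C for matrices with no zero entry. -/

variable {H : Type*} [NormedAddCommGroup H] [InnerProductSpace ℂ H] [CompleteSpace H]

namespace IsShiftModel

variable {J : FundamentalSymmetry H} {S : H →ₗ.[ℂ] H} {T : H →L[ℂ] H} {e : DefectBasis J S}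
  (h : IsShiftModel J S T e)

include h

/-- With q = |u₁₁|, r = |u₁₂| and α = u₁₁/q, take C = J(1 - qR)/r, where R sends e_{++} to α e_{+-}
and e_{-+} to α conj(δ) e_{--}. The condition a² - b² = 1 is q² + r² = 1, and r ≠ 0 is essential. -/
theorem extOfMatrix_mem_SigmaJst {U : Matrix (Fin 2) (Fin 2) ℂ}
    (hU : U ∈ Matrix.unitaryGroup (Fin 2) ℂ) (h0 : U 0 0 ≠ 0) (h1 : U 0 1 ≠ 0) :
    extOfMatrix e U ∈ SigmaJst J S := by
  obtain ⟨δ, hδ, h11, h10, hrow⟩ := unitary_fin_two hU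
  obtain ⟨q, hq⟩ : ∃ q, q = ‖U 0 0‖ := ⟨_, rfl⟩
  obtain ⟨r, hr⟩ : ∃ r, r = ‖U 0 1‖ := ⟨_, rfl⟩
  have hqpos : 0 < q := hq ▸ norm_pos_iff.2 h0
  have hrpos : 0 < r := hr ▸ norm_pos_iff.2 h1
  have hqc : (q : ℂ) ≠ 0 := by exact_mod_cast hqpos.ne'
  have hrc : (r : ℂ) ≠ 0 := by exact_mod_cast hrpos.ne'
  rw [Complex.conj_mul', Complex.conj_mul', ← hq, ← hr] at hrow
  have hqr : q ^ 2 + r ^ 2 = 1 := by exact_mod_cast hrow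
  obtain ⟨α, hα⟩ : ∃ α : ℂ, α = (q : ℂ)⁻¹ * U 0 0 := ⟨_, rfl⟩
  have hαn : ‖α‖ = 1 := by
    rw [hα, norm_mul, norm_inv, Complex.norm_real, Real.norm_of_nonneg hqpos.le, ← hq,
      inv_mul_cancel₀ hqpos.ne']
  have hU0 : U 0 0 = q * α := by rw [hα, mul_inv_cancel_left₀ hqc]
  have hαα := conj_mul_self_of_norm_eq_one hαn
  have hδδ := conj_mul_self_of_norm_eq_one hδ
  have hss : (starRingEnd ℂ) (U 0 1) * U 0 1 = (r : ℂ) ^ 2 := by rw [Complex.conj_mul', hr]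
  have hα'n : ‖(starRingEnd ℂ) α‖ = 1 := by rw [Complex.norm_conj, hαn]
  have hδ'n : ‖(starRingEnd ℂ) δ‖ = 1 := by rw [Complex.norm_conj, hδ]
  rw [hU0, map_mul, Complex.conj_ofReal] at h11
  -- With the conjugates turned into free letters, the invariance of M_U becomes polynomial
  -- identities modulo α'α = 1, δ'δ = 1, s'u₁₂ = r² and q² + r² = 1.
  generalize (starRingEnd ℂ) α = α' at hαα hα'n h11
  generalize (starRingEnd ℂ) δ = δ' at hδδ hδ'n
  generalize (starRingEnd ℂ) (U 0 1) = s' at hss h10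
  obtain ⟨R, hn, hin, hRR, hRJ, hRS, hRe⟩ := h.exists_swap
    (fun k s => bif k then (bif s then α else α') else (bif s then α * δ' else α' * δ))
    (fun k s => by cases k <;> cases s <;> simp [hαn, hα'n, hδ, hδ'n])
    (fun k s => by
      have h2 : α * δ' * (α' * δ) = 1 := by linear_combination δ' * δ * hαα + hδδ
      cases k <;> cases s
      · exact (mul_comm _ _).trans h2
      · exact h2
      · exact hαα
      · exact (mul_comm _ _).trans hαα)
  have hab : (1 / r) ^ 2 - (-q / r) ^ 2 = 1 := by
    field_simp
    linarith
  have hC := op_mul_mem_CSymmetries h.comm hn hin hRR hRJ hRS (one_div_pos.2 hrpos) hab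
  obtain ⟨ρ, hρ⟩ : ∃ ρ : ℂ, ρ = (r : ℂ)⁻¹ := ⟨_, rfl⟩
  have hρr : ρ * r = 1 := by rw [hρ, inv_mul_cancel₀ hrc]
  set C := J.op * (((1 / r : ℝ) : ℂ) • 1 + ((-q / r : ℝ) : ℂ) • R) with hCdef
  have hCx : ∀ x, C x = J.op (ρ • x + (-(q * ρ)) • R x) := by
    intro x
    simp only [hCdef, mul_apply_eq_comp, add_apply, smul_apply, one_apply_eq_self, hρ]
    push_cast
    rw [one_div, neg_div, div_eq_mul_inv]
  have hCcomb : ∀ a b c d, C (e.comb a b c d) = e.comb (ρ * a - q * ρ * α' * b)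
      (-(ρ * b - q * ρ * α * a)) (ρ * c - q * ρ * (α' * δ) * d)
      (-(ρ * d - q * ρ * (α * δ') * c)) := by
    intro a b c d
    have : ρ • e.comb a b c d + (-(q * ρ)) • R (e.comb a b c d) =
        e.comb (ρ * a - q * ρ * α' * b) (ρ * b - q * ρ * α * a)
          (ρ * c - q * ρ * (α' * δ) * d) (ρ * d - q * ρ * (α * δ') * c) := by
      simp only [DefectBasis.comb, map_add, map_smul, hRe, cond_true, cond_false, Bool.not_true,
        Bool.not_false]
      module
    rw [hCx, this, e.op_comb]
  have hRadj : ContinuousLinearMap.adjoint R = R :=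
    ContinuousLinearMap.isSelfAdjoint_iff'.1
      (ContinuousLinearMap.isSelfAdjoint_iff_isSymmetric.2 hin)
  refine ⟨h.extOfMatrix_mem_SigmaJ hU, C, hC, commutes_extOfMatrix (fun x => ?_)
    (fun u v => hC.2.2.mem_graph) (fun u v huv => ?_) ?_ ?_⟩
  · exact congrArg (fun A : H →L[ℂ] H => A x) hC.1
  · rw [hCx, hCx]
    have h2 := h.symm.adjoint_map_mem (C := R) (by rw [hRadj]; exact hRS) huv
    exact J.adjoint_graph_map h.symm h.comm (graph_add (graph_smul _ huv) (graph_smul _ h2))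
  -- The coefficients are the e_{++} and e_{--} coordinates of C d₁, the first being ρ(1 - q²) = r;
  -- likewise for d₂ below.
  · refine ⟨r, q * ρ * (α * δ') * U 0 1, ?_⟩
    rw [hCcomb, hU0, h11, h10]
    congr 1 <;> grind
  · refine ⟨q * ρ * α' * δ * s', -r, ?_⟩
    rw [hCcomb, hU0, h11, h10]
    congr 1 <;> grind

end IsShiftModel

end KreinExt

/-! ### The theorem. -/

theorem theorem4p5 {H : Type*} [NormedAddCommGroup H] [InnerProductSpace ℂ H] [CompleteSpace H]
    (J : KreinExt.FundamentalSymmetry H) (S : H →ₗ.[ℂ] H)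
    (hS_dense : Dense (S.domain : Set H)) (hS_closed : S.IsClosed)
    (hS_symm : S.IsFormalAdjoint S) (hSJ : KreinExt.Commutes S J.op)
    (hS_plus : KreinExt.HasDeficiencyIndicesOne (KreinExt.part S J.plus))
    (hS_minus : KreinExt.HasDeficiencyIndicesOne (KreinExt.part S J.minus))
    (hS_simple : KreinExt.IsSimple S) (hSh : KreinExt.HasZeroCharFunction S) :
    KreinExt.UpsilonU J S = ∅ ∧
    KreinExt.UpsilonU J S ⊂ KreinExt.UpsilonJ J S ∧
    KreinExt.UpsilonJ J S ⊂ KreinExt.SigmaJst J S ∧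
    ∀ e : KreinExt.DefectBasis J S, ∀ U ∈ Matrix.unitaryGroup (Fin 2) ℂ,
      (KreinExt.extOfMatrix e U ∈ KreinExt.UpsilonJ J S ↔
        ∃ φ ∈ Set.Ico 0 (2 * Real.pi), ∃ ξ ∈ Set.Ico 0 (2 * Real.pi),
          U = Complex.exp (Complex.I * φ) •
            !![0, Complex.exp (Complex.I * ξ);
               -Complex.exp (-(Complex.I * ξ)), 0]) ∧
      (KreinExt.extOfMatrix e U ∈ KreinExt.SigmaJst J S \ KreinExt.UpsilonJ J S ↔
        ∃ φ ∈ Set.Ico 0 (2 * Real.pi), ∃ γ ∈ Set.Ico 0 (2 * Real.pi),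
          ∃ ξ ∈ Set.Ico 0 (2 * Real.pi), ∃ q r : ℝ, 0 < q ∧ 0 < r ∧ q ^ 2 + r ^ 2 = 1 ∧
          U = Complex.exp (Complex.I * φ) •
            !![q * Complex.exp (Complex.I * γ), r * Complex.exp (Complex.I * ξ);
               -(r * Complex.exp (-(Complex.I * ξ))), q * Complex.exp (-(Complex.I * γ))]) := by
  have hsymm := KreinExt.isDenselySymmetric_of_isFormalAdjoint hS_dense hS_symm
  obtain ⟨T, hT⟩ := hsymm.exists_isCayley hS_closed
  have hmodel : ∀ e : KreinExt.DefectBasis J S, KreinExt.IsShiftModel J S T e := fun e =>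
    ⟨hsymm, hS_closed, hSJ, hS_simple, hT, e.epp_ne_zero hS_plus,
      fun hn hm k => hsymm.inner_defect_pow_adjoint_cayley hS_closed hSh hT hn hm k⟩
  have hUpsilonJ : ∀ e : KreinExt.DefectBasis J S, ∀ U ∈ Matrix.unitaryGroup (Fin 2) ℂ,
      (KreinExt.extOfMatrix e U ∈ KreinExt.UpsilonJ J S ↔ U 0 0 = 0) := by
    intro e U hU
    refine (hmodel e).extOfMatrix_mem_UpsilonJ_iff hU fun h0 => ?_
    obtain ⟨δ, -, h11, -, -⟩ := KreinExt.unitary_fin_two hU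
    rw [h11, h0, map_zero, mul_zero]
  have hdiff : ∀ e : KreinExt.DefectBasis J S, ∀ U ∈ Matrix.unitaryGroup (Fin 2) ℂ,
      (KreinExt.extOfMatrix e U ∈ KreinExt.SigmaJst J S \ KreinExt.UpsilonJ J S ↔
        U 0 0 ≠ 0 ∧ U 0 1 ≠ 0) := by
    intro e U hU
    rw [Set.mem_sdiff, hUpsilonJ e U hU, and_comm]
    obtain ⟨-, -, -, -, hrow⟩ := KreinExt.unitary_fin_two hU
    exact and_congr_right fun h0 => ⟨fun h1 => (hmodel e).ne_zero_of_mem_SigmaJst hrow h1,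
      fun h1 => (hmodel e).extOfMatrix_mem_SigmaJst hU h0 h1⟩
  obtain ⟨e⟩ := KreinExt.exists_defectBasis hS_plus hS_minus
  have hempty := (hmodel e).UpsilonU_eq_empty
  refine ⟨hempty, ?_, ?_, fun e U hU => ⟨?_, ?_⟩⟩
  · rw [hempty, Set.empty_ssubset]
    refine ⟨_, (hUpsilonJ e !![0, 1; -1, 0] ?_).2 rfl⟩
    rw [Matrix.mem_unitaryGroup_iff]
    ext i j
    fin_cases i <;> fin_cases j <;> simp [Matrix.mul_apply, Fin.sum_univ_two]
  · refine ⟨KreinExt.UpsilonJ_subset_SigmaJst hSJ, fun hsub => ?_⟩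
    -- Any unitary matrix with u₁₁ and u₁₂ nonzero shows strictness; the Pythagorean triple keeps
    -- the entries rational.
    have hU : !![(3 / 5 : ℂ), 4 / 5; -4 / 5, 3 / 5] ∈ Matrix.unitaryGroup (Fin 2) ℂ := by
      rw [Matrix.mem_unitaryGroup_iff]
      ext i j
      fin_cases i <;> fin_cases j <;> 
        simp [Matrix.mul_apply, Fin.sum_univ_two, Complex.conj_ofNat] <;> norm_num
    have h1 := (hdiff e _ hU).2 (by constructor <;> simp)
    exact h1.2 (hsub h1.1)
  · rw [hUpsilonJ e U hU, KreinExt.unitary_offDiag_iff hU]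
  · rw [hdiff e U hU, KreinExt.unitary_full_iff hU]
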